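/- Let $k$ be an algebraically closed field. A *tensor category* over $k$ is a $k$-linear abelian rigid monoidal category with $k$-bilinear tensor product, finite-dimensional Hom spaces, all objects of finite length, and simple unit object $\mathbf 1$; a *braided* tensor category is one endowed with a braiding (a natural isomorphism $X\otimes Y\to Y\otimes X$ satisfying the two hexagon identities). Associativity and unit constraints of $\mathcal C$ are suppressed below. Let $(G,\Gamma)$ be a matched pair of finite groups: there are a left action $\rhd:\Gamma\times G\to G$ and a right action $\lhd:\Gamma\times G\to\Gamma$ on sets with $s\rhd gh=(s\rhd g)((s\lhd g)\rhd h)$ and $st\lhd g=(s\lhd(t\rhd g))(t\lhd g)$. A *$(G,\Gamma)$-crossed tensor category* is a tensor category $\mathcal C$ over $k$ with: * a grading $\mathcal C=\bigoplus_{s\in\Gamma}\mathcal C_s$ by full subcategories closed under isomorphism (every object is a direct sum $\bigoplus_s X_s$ with $X_s\in\mathcal C_s$; $\operatorname{Hom}(\mathcal C_s,\mathcal C_t)=0$ for $s\ne t$; $\mathcal C_s\otimes\mathcal C_t\subseteq\mathcal C_{st}$); * a right action of $G$ by $k$-linear autoequivalences $\rho^g$, with coherent natural isomorphisms $\rho_2^{g,h}:\rho^g\rho^h\to\rho^{hg}$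 and $\rho_0:\mathrm{id}\to\rho^e$, such that $\rho^g(\mathcal C_s)=\mathcal C_{s\lhd g}$ (essential image); * natural isomorphisms $\gamma^g_{X,Y}:\rho^g(X\otimes Y)\to\rho^{t\rhd g}(X)\otimes\rho^g(Y)$ for $X\in\mathcal C$, $Y\in\mathcal C_t$, and isomorphisms $\gamma^g_0:\rho^g(\mathbf 1)\to\mathbf 1$, such that, for all $g,h\in G$, $X\in\mathcal C$, $Y\in\mathcal C_s$, $Z\in\mathcal C_t$: * (a) $(\gamma^{t\rhd g}_{X,Y}\otimes\mathrm{id})\,\gamma^g_{X\otimes Y,Z}=(\mathrm{id}\otimes\gamma^g_{Y,Z})\,\gamma^g_{X,Y\otimes Z}$; * (b) $(\mathrm{id}\otimes\gamma_0^g)\,\gamma^g_{X,\mathbf 1}=\mathrm{id}_{\rho^g(X)}$ and $(\gamma_0^{s\rhd g}\otimes\mathrm{id})\,\gamma^g_{\mathbf 1,Y}=\mathrm{id}_{\rho^g(Y)}$; * (c) $\gamma^{hg}_{X,Y}\,\rho_2^{g,h}=(\rho_2^{(s\lhd h)\rhd g,\,s\rhd h}\otimes\rho_2^{g,h})\,\gamma^g_{\rho^{s\rhd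 h}(X),\rho^h(Y)}\,\rho^g(\gamma^h_{X,Y})$; * (d) $\gamma_0^{hg}\,(\rho_2^{g,h})_{\mathbf 1}=\gamma_0^g\,\rho^g(\gamma_0^h)$; * (e) $\gamma^e_{X,Y}\,(\rho_0)_{X\otimes Y}=(\rho_0)_X\otimes(\rho_0)_Y$ and $\gamma_0^e\,(\rho_0)_{\mathbf 1}=\mathrm{id}_{\mathbf 1}$. The category $\mathcal C^{(G,\Gamma)}$ has as objects the pairs $(X,r)$ with isomorphisms $r^g:\rho^g(X)\to X$ ($g\in G$) satisfying $r^g\rho^g(r^h)=r^{hg}\rho_2^{g,h}$ and $r^e\rho_0=\mathrm{id}$, and as morphisms the morphisms of $\mathcal C$ that commute with these. Its tensor product is $(X,r)\otimes(Y,l)=(X\otimes Y,\tilde r)$, where $\tilde r^g$ is $(r^{s\rhd g}\otimes l^g)\,\gamma^g_{X,Y_s}$ on the summand $\rho^g(X\otimes Y_s)$; its unit object is $(\mathbf 1,\gamma_0)$; its constraints are those of $\mathcal C$. A *$(G,\Gamma)$-crossed braiding* in $\mathcal C$ is a triple $(c,\varphi,\psi)$ of group homomorphisms $\varphi,\psi:\Gamma\to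 G$ and natural isomorphisms $$c_{X,Y}:X\otimes Y\to\rho^{s\prec t}(Y)\otimes\rho^{\psi(t)}(X),\qquad X\in\mathcal C_s,\ Y\in\mathcal C_t,\qquad s\prec t:=t^{-1}\rhd\varphi(s^{-1}),$$ such that, for all $s,t\in\Gamma$, $g\in G$, $$(t^{-1}\lhd\varphi(s^{-1}))st=s\lhd\psi(t),\quad (t\rhd\psi(s))^{-1}=\psi(s^{-1}\lhd\varphi(t^{-1})),\quad (t^{-1}\rhd\varphi(s^{-1}))^{-1}=\varphi(s\lhd\psi(t)),$$ $$\psi(t)g=(t\rhd g)\psi(t\lhd g),\qquad g\,\varphi(s\lhd g)^{-1}=\varphi(s^{-1})(s\rhd g),$$ and, for all $X\in\mathcal C_s$, $Y\in\mathcal C_t$, $Z\in\mathcal C_u$, $g\in G$ (each $c$ being taken for the degrees of its arguments as they result from the grading), 1. $(\rho_2\otimes\rho_2)\,c_{\rho^{t\rhd g}(X),\rho^g(Y)}\,\gamma^g_{X,Y}=(\rho_2\otimes\rho_2)\,\gamma^g_{\rho^{s\prec t}(Y),\rho^{\psi(t)}(X)}\,\rho^g(c_{X,Y})$; 2. $(\mathrm{id}\otimes\gamma^{\psi(u)}_{X,Y})\,c_{X\otimes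 Y,Z}=(\rho_2\otimes\mathrm{id}\otimes\mathrm{id})\,(c_{X,\rho^{t\prec u}(Z)}\otimes\mathrm{id})\,(\mathrm{id}\otimes c_{Y,Z})$; 3. $(\gamma^{s\prec tu}_{Y,Z}\otimes\mathrm{id})\,c_{X,Y\otimes Z}=(\mathrm{id}\otimes\mathrm{id}\otimes\rho_2)\,(\mathrm{id}\otimes c_{\rho^{\psi(t)}(X),Z})\,(c_{X,Y}\otimes\mathrm{id})$. **Theorem.** Let $\mathcal C$ be a $(G,\Gamma)$-crossed tensor category and let $(c,\varphi,\psi)$ be a $(G,\Gamma)$-crossed braiding in $\mathcal C$. Then $\mathcal C^{(G,\Gamma)}$ is a braided tensor category over $k$, with a braiding $(X,r)\otimes(Y,l)\to(Y,l)\otimes(X,r)$ that is given, for any decompositions $X=\bigoplus_{s}X_s$ and $Y=\bigoplus_{t}Y_t$ into homogeneous objects, componentwise by the isomorphisms $$(l^{t^{-1}\rhd\varphi(s^{-1})}\otimes r^{\psi(t)})\,c_{X_s,Y_t}:X_s\otimes Y_t\to Y_{t\lhd(t^{-1}\rhd\varphi(s^{-1}))}\otimes X_{s\lhd\psi(t)},\qquad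 s,t\in\Gamma .$$ -/

import Mathlib

open CategoryTheory MonoidalCategory Limits

universe w v u

noncomputable section

/-- `C` is a tensor category over the field `k`: a `k`-linear abelian rigid monoidal category with
`k`-bilinear tensor product, finite dimensional Hom spaces, objects of finite length and simple
unit object. (The first five fields are those of Mathlib's `Abelian`, for the given preadditive
structure; an object has finite length iff it is Noetherian and Artinian.) -/
class TensorCategory (k : Type w) [Field k] (C : Type u) [Category.{v} C] [Preadditive C]
    [Linear k C] [MonoidalCategory C] [MonoidalPreadditive C] [MonoidalLinear k C] : Prop where
  hasFiniteProducts : HasFiniteProducts C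
  hasKernels : HasKernels C
  hasCokernels : HasCokernels C
  isNormalMonoCategory : IsNormalMonoCategory C
  isNormalEpiCategory : IsNormalEpiCategory C
  rigid : Nonempty (RigidCategory C)
  finiteDimensional_hom : ∀ X Y : C, FiniteDimensional k (X ⟶ Y)
  isNoetherianObject : ∀ X : C, IsNoetherianObject X
  isArtinianObject : ∀ X : C, IsArtinianObject X
  simple_unit : Simple (𝟙_ C)

/-- A matched pair of groups `(G, Γ)`: a left action `s ▷ g` (`lact s g`) of `Γ` on the set `G` and
a right action `s ◁ g` (`ract s g`) of `G` on the set `Γ`, with the two compatibilities. -/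
structure MatchedPair (G Γ : Type*) [Group G] [Group Γ] where
  lact : Γ → G → G
  ract : Γ → G → Γ
  one_lact : ∀ g, lact 1 g = g
  mul_lact : ∀ s t g, lact (s * t) g = lact s (lact t g)
  ract_one : ∀ s, ract s 1 = s
  ract_mul : ∀ s g h, ract s (g * h) = ract (ract s g) h
  lact_mul : ∀ s g h, lact s (g * h) = lact s g * lact (ract s g) h
  mul_ract : ∀ s t g, ract (s * t) g = ract s (lact t g) * ract t g

namespace MatchedPair

variable {G Γ : Type*} [Group G] [Group Γ] (P : MatchedPair G Γ)

lemma lact_one (s : Γ) : P.lact s 1 = 1 := by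
  have h := P.lact_mul s 1 1
  rw [mul_one, P.ract_one] at h
  exact left_eq_mul.1 h

lemma lact_inv_lact (s : Γ) (g : G) : P.lact s⁻¹ (P.lact s g) = g := by
  rw [← P.mul_lact, inv_mul_cancel, P.one_lact]

lemma lact_lact_inv (s : Γ) (g : G) : P.lact s (P.lact s⁻¹ g) = g := by
  rw [← P.mul_lact, mul_inv_cancel, P.one_lact]

lemma one_ract (g : G) : P.ract 1 g = 1 := by
  have h := P.mul_ract 1 1 g
  rw [mul_one, P.one_lact] at h
  exact left_eq_mul.1 h

lemma ract_lact_inv (t : Γ) (g : G) : P.ract t (P.lact t⁻¹ g) = (P.ract t⁻¹ g)⁻¹ := by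
  have h := P.mul_ract t t⁻¹ g
  rw [mul_inv_cancel, P.one_ract] at h
  exact eq_inv_of_mul_eq_one_left h.symm

lemma ract_inv_lact (t : Γ) (g : G) : P.ract t⁻¹ (P.lact t g) = (P.ract t g)⁻¹ := by
  have h := P.ract_lact_inv t⁻¹ g
  rwa [inv_inv] at h

end MatchedPair

/-- A right action of the group `G` on the `k`-linear category `C`, by `k`-linear functors `ρ g`
with natural isomorphisms `ρ₂ g h : ρ^g ρ^h ≅ ρ^{hg}` and `ρ₀ : id ≅ ρ^e`. (The `ρ g` are then
autoequivalences.) -/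
structure RightAction (k : Type w) [Field k] (G : Type*) [Group G] (C : Type u) [Category.{v} C]
    [Preadditive C] [Linear k C] where
  ρ : G → C ⥤ C
  additive : ∀ g, (ρ g).Additive
  linear : ∀ g, (ρ g).Linear k
  ρ₂ : ∀ g h : G, ρ h ⋙ ρ g ≅ ρ (h * g)
  ρ₀ : 𝟭 C ≅ ρ 1
  assoc : ∀ (a b c : G) (X : C),
    (ρ₂ a b).hom.app ((ρ c).obj X) ≫ (ρ₂ (b * a) c).hom.app X =
      (ρ a).map ((ρ₂ b c).hom.app X) ≫ (ρ₂ a (c * b)).hom.app X ≫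
        eqToHom (by rw [mul_assoc])
  unit_left : ∀ (a : G) (X : C),
    (ρ a).map (ρ₀.hom.app X) ≫ (ρ₂ a 1).hom.app X = eqToHom (by rw [one_mul]; rfl)
  unit_right : ∀ (a : G) (X : C),
    ρ₀.hom.app ((ρ a).obj X) ≫ (ρ₂ 1 a).hom.app X = eqToHom (by rw [mul_one]; rfl)

attribute [instance] RightAction.additive RightAction.linear

namespace RightAction

variable {k : Type w} [Field k] {G : Type*} [Group G] {C : Type u} [Category.{v} C]
    [Preadditive C] [Linear k C] (A : RightAction k G C)

/-- The identification `ρ^a(X) = ρ^b(X)` for `a = b`. -/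
def tr {a b : G} (h : a = b) (X : C) : (A.ρ a).obj X ⟶ (A.ρ b).obj X :=
  eqToHom (by rw [h])

lemma faithful (g : G) : (A.ρ g).Faithful :=
  Functor.Faithful.of_comp_iso
    (A.ρ₂ g⁻¹ g ≪≫ eqToIso (by rw [mul_inv_cancel]) ≪≫ A.ρ₀.symm)

/-- An equivariant object `(X, r)`. -/
structure EquivariantObject where
  obj : C
  r : ∀ g : G, (A.ρ g).obj obj ⟶ obj
  isIso_r : ∀ g : G, IsIso (r g)
  r_mul : ∀ g h : G, (A.ρ g).map (r h) ≫ r g = (A.ρ₂ g h).hom.app obj ≫ r (h * g)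
  r_one : A.ρ₀.hom.app obj ≫ r 1 = 𝟙 obj


lemma isIso_of_mul_one {X : C} (r : ∀ g : G, (A.ρ g).obj X ⟶ X)
    (mul : ∀ g h : G, (A.ρ g).map (r h) ≫ r g = (A.ρ₂ g h).hom.app X ≫ r (h * g))
    (one : A.ρ₀.hom.app X ≫ r 1 = 𝟙 X) (g : G) : IsIso (r g) := by
  have h1 : IsIso (r 1) := by
    have h : r 1 = inv (A.ρ₀.hom.app X) := IsIso.eq_inv_of_hom_inv_id one
    rw [h]; infer_instance
  have h2 : ∀ a : G, a = 1 → IsIso (r a) := by rintro _ rfl; exact h1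
  have h3 : ∀ a b : G, b * a = 1 → IsIso ((A.ρ a).map (r b) ≫ r a) := by
    intro a b hab
    have := h2 _ hab
    rw [mul]
    infer_instance
  have := A.faithful g⁻¹
  have := h3 g g⁻¹ (inv_mul_cancel g)
  have hepi : IsSplitEpi (r g) :=
    ⟨⟨⟨inv ((A.ρ g).map (r g⁻¹) ≫ r g) ≫ (A.ρ g).map (r g⁻¹), by
      rw [Category.assoc, IsIso.inv_hom_id]⟩⟩⟩
  have := h3 g⁻¹ g (mul_inv_cancel g)
  have hmono' : Mono ((A.ρ g⁻¹).map (r g)) :=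
    mono_of_mono ((A.ρ g⁻¹).map (r g)) (r g⁻¹)
  have hmono : Mono (r g) := (A.ρ g⁻¹).mono_of_mono_map hmono'
  exact isIso_of_mono_of_isSplitEpi _

variable {A}

namespace EquivariantObject

attribute [instance] isIso_r

lemma tr_r (X : A.EquivariantObject) {a b : G} (h : a = b) :
    A.tr h X.obj ≫ X.r b = X.r a := by
  subst h
  simp [tr]

/-- An equivariant morphism. -/
@[ext]
structure Hom (X Y : A.EquivariantObject) where
  hom : X.obj ⟶ Y.obj
  comm : ∀ g : G, X.r g ≫ hom = (A.ρ g).map hom ≫ Y.r g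

/-- The equivariantization `C^G`. -/
instance : Category A.EquivariantObject where
  Hom := Hom
  id X := ⟨𝟙 _, by simp⟩
  comp f g := ⟨f.hom ≫ g.hom, fun a => by
    rw [← Category.assoc, f.comm, Category.assoc, g.comm, Functor.map_comp, Category.assoc]⟩

@[ext]
lemma hom_ext {X Y : A.EquivariantObject} {f g : X ⟶ Y} (h : f.hom = g.hom) : f = g :=
  Hom.ext h

@[simp]
lemma id_hom (X : A.EquivariantObject) : Hom.hom (𝟙 X) = 𝟙 X.obj := rfl

@[simp]
lemma comp_hom {X Y Z : A.EquivariantObject} (f : X ⟶ Y) (g : Y ⟶ Z) :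
    (f ≫ g).hom = f.hom ≫ g.hom := rfl

/-- An isomorphism of `C` whose direct map is equivariant is one of equivariant objects. -/
def mkIso {X Y : A.EquivariantObject} (e : X.obj ≅ Y.obj)
    (h : ∀ g : G, X.r g ≫ e.hom = (A.ρ g).map e.hom ≫ Y.r g) : X ≅ Y where
  hom := ⟨e.hom, h⟩
  inv := ⟨e.inv, fun g => by
    rw [← cancel_mono e.hom, Category.assoc, Category.assoc, e.inv_hom_id, h,
      ← Functor.map_comp_assoc, e.inv_hom_id]
    simp⟩

@[simp]
lemma mkIso_hom_hom {X Y : A.EquivariantObject} (e : X.obj ≅ Y.obj) (h) :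
    (mkIso e h).hom.hom = e.hom := rfl

@[simp]
lemma mkIso_inv_hom {X Y : A.EquivariantObject} (e : X.obj ≅ Y.obj) (h) :
    (mkIso e h).inv.hom = e.inv := rfl

variable (X Y : A.EquivariantObject)

/-- The equivariant morphisms as a subspace of the morphisms of `C`. -/
def homSubmodule : Submodule k (X.obj ⟶ Y.obj) where
  carrier := {f | ∀ g : G, X.r g ≫ f = (A.ρ g).map f ≫ Y.r g}
  add_mem' {f f'} hf hf' g := by
    rw [Preadditive.comp_add, hf, hf', Functor.map_add, Preadditive.add_comp]
  zero_mem' g := by simp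
  smul_mem' a f hf g := by
    rw [Linear.comp_smul, hf, Functor.map_smul, Linear.smul_comp]

/-- Equivariant morphisms are the elements of `homSubmodule`. -/
def homEquiv : (X ⟶ Y) ≃ homSubmodule X Y where
  toFun f := ⟨f.hom, f.comm⟩
  invFun f := ⟨f.1, f.2⟩
  left_inv _ := rfl
  right_inv _ := rfl

instance : AddCommGroup (X ⟶ Y) := (homEquiv X Y).addCommGroup

instance : Module k (X ⟶ Y) := (homEquiv X Y).module k

variable {X Y}

@[simp]
lemma add_hom (f g : X ⟶ Y) : (f + g).hom = f.hom + g.hom := rfl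

@[simp]
lemma zero_hom : (0 : X ⟶ Y).hom = 0 := rfl

@[simp]
lemma smul_hom (a : k) (f : X ⟶ Y) : (a • f).hom = a • f.hom := rfl

instance : Preadditive A.EquivariantObject where

instance : Linear k A.EquivariantObject where

end EquivariantObject

end RightAction

/-- A grading of the monoidal category `C` by the finite group `Γ`: isomorphism-closed full
subcategories `C_s`, such that each object is a direct sum of homogeneous ones. -/
structure Grading (Γ : Type*) [Group Γ] [Fintype Γ] (C : Type u) [Category.{v} C]
    [Preadditive C] [MonoidalCategory C] where
  deg : Γ → ObjectProperty C
  isClosedUnderIsomorphisms : ∀ s, (deg s).IsClosedUnderIsomorphisms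
  hom_eq_zero : ∀ {s t : Γ} {X Y : C}, deg s X → deg t Y → s ≠ t → ∀ f : X ⟶ Y, f = 0
  tensor_mem : ∀ {s t : Γ} {X Y : C}, deg s X → deg t Y → deg (s * t) (X ⊗ Y)
  exists_decomp : ∀ X : C, ∃ (Y : Γ → C) (ι : ∀ s, Y s ⟶ X) (π : ∀ s, X ⟶ Y s),
    (∀ s, deg s (Y s)) ∧ (∀ s, ι s ≫ π s = 𝟙 (Y s)) ∧
      (∀ s t, s ≠ t → ι s ≫ π t = 0) ∧ ∑ s, π s ≫ ι s = 𝟙 X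

attribute [instance] Grading.isClosedUnderIsomorphisms

namespace Grading

variable {Γ : Type*} [Group Γ] [Fintype Γ] {C : Type u} [Category.{v} C]
    [Preadditive C] [MonoidalCategory C] (𝒢 : Grading Γ C)

/-- A decomposition `X ≅ ⨁ X_s` of `X` as a direct sum of homogeneous objects `X_s ∈ C_s`. -/
structure Decomposition (X : C) where
  comp : Γ → C
  mem : ∀ s, 𝒢.deg s (comp s)
  ι : ∀ s, comp s ⟶ X
  π : ∀ s, X ⟶ comp s
  ι_π_self : ∀ s, ι s ≫ π s = 𝟙 (comp s)
  ι_π_ne : ∀ s t, s ≠ t → ι s ≫ π t = 0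
  sum_π_ι : ∑ s, π s ≫ ι s = 𝟙 X

/-- A chosen decomposition of `X`. -/
def decomp (X : C) : 𝒢.Decomposition X :=
  Nonempty.some <| by
    obtain ⟨Y, ι, π, h₁, h₂, h₃, h₄⟩ := 𝒢.exists_decomp X
    exact ⟨⟨Y, h₁, ι, π, h₂, h₃, h₄⟩⟩

variable {𝒢}

lemma Decomposition.hom_ext {X : C} (D : 𝒢.Decomposition X) (F : C ⥤ C) [F.Additive] {Z : C}
    {f g : F.obj X ⟶ Z} (h : ∀ s, F.map (D.ι s) ≫ f = F.map (D.ι s) ≫ g) : f = g := by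
  rw [← Category.id_comp f, ← Category.id_comp g, ← F.map_id, ← D.sum_π_ι, F.map_sum,
    Preadditive.sum_comp, Preadditive.sum_comp]
  refine Finset.sum_congr rfl fun s _ => ?_
  rw [F.map_comp, Category.assoc, h, Category.assoc]

variable (𝒢)

/-- The unit object of a graded tensor category is homogeneous of trivial degree. -/
lemma unit_mem (k : Type w) [Field k] [Linear k C] [MonoidalPreadditive C] [MonoidalLinear k C]
    [TensorCategory k C] : 𝒢.deg 1 (𝟙_ C) := by
  have hS : Simple (𝟙_ C) := TensorCategory.simple_unit k
  obtain ⟨Y, ι, π, h₁, h₂, h₃, h₄⟩ := 𝒢.exists_decomp (𝟙_ C)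
  have hne : ∃ s, ι s ≠ 0 := by
    by_contra hcon
    push Not at hcon
    apply id_nonzero (𝟙_ C)
    rw [← h₄]
    exact Finset.sum_eq_zero fun s _ => by rw [hcon, comp_zero]
  obtain ⟨s, hs⟩ := hne
  have hm : IsSplitMono (ι s) := ⟨⟨⟨π s, h₂ s⟩⟩⟩
  have hi : IsIso (ι s) := isIso_of_mono_of_nonzero hs
  have hmem : 𝒢.deg s (𝟙_ C) := (𝒢.deg s).prop_of_iso (asIso (ι s)) (h₁ s)
  have hmem' : 𝒢.deg (s * s) (𝟙_ C) :=
    (𝒢.deg (s * s)).prop_of_iso (λ_ (𝟙_ C)) (𝒢.tensor_mem hmem hmem)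
  have hss : s * s = s := by
    by_contra hcon
    exact id_nonzero (𝟙_ C) (𝒢.hom_eq_zero hmem' hmem hcon (𝟙 _))
  rw [mul_eq_right] at hss
  rwa [hss] at hmem

end Grading

/-- A pair of group homomorphisms `φ, ψ : Γ → G` satisfying the five conditions required of the
group-theoretical part of a crossed braiding. -/
structure BraidingHoms {G Γ : Type*} [Group G] [Group Γ] (P : MatchedPair G Γ) where
  φ : Γ →* G
  ψ : Γ →* G
  ract_eq : ∀ s t, P.ract t⁻¹ (φ s⁻¹) * s * t = P.ract s (ψ t)
  lact_ψ : ∀ s t, (P.lact t (ψ s))⁻¹ = ψ (P.ract s⁻¹ (φ t⁻¹))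
  lact_φ : ∀ s t, (P.lact t⁻¹ (φ s⁻¹))⁻¹ = φ (P.ract s (ψ t))
  ψ_mul : ∀ t g, ψ t * g = P.lact t g * ψ (P.ract t g)
  mul_φ : ∀ s g, g * (φ (P.ract s g))⁻¹ = φ s⁻¹ * P.lact s g

namespace BraidingHoms

variable {G Γ : Type*} [Group G] [Group Γ] {P : MatchedPair G Γ} (B : BraidingHoms P)

/-- The element `t⁻¹ ▷ φ(s⁻¹)` of `G`. -/
abbrev lt (s t : Γ) : G := P.lact t⁻¹ (B.φ s⁻¹)

lemma mul_lt (s t : Γ) (g : G) :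
    g * B.lt (P.ract s (P.lact t g)) (P.ract t g) =
      B.lt s t * P.lact (P.ract s (B.ψ t)) g := by
  have h := P.lact_mul t⁻¹ (P.lact t g) (B.φ (P.ract s (P.lact t g)))⁻¹
  rw [P.lact_inv_lact, P.ract_inv_lact, B.mul_φ, P.lact_mul, ← P.mul_lact, ← P.mul_lact,
    B.ract_eq] at h
  rw [lt, lt, map_inv, ← h]

lemma lt_mul_lt (s t u : Γ) : B.lt t u * B.lt s (P.ract u (B.lt t u)) = B.lt (s * t) u := by
  simp only [lt]
  rw [P.ract_lact_inv, inv_inv, mul_inv_rev, map_mul, P.lact_mul]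

lemma ψ_ract_lt (t u : Γ) : B.ψ (P.ract u (B.lt t u)) = P.lact t (B.ψ u) := by
  rw [lt, P.ract_lact_inv, map_inv, ← B.lact_ψ, inv_inv]

lemma lt_eq (s t u : Γ) : B.lt s t = P.lact u (B.lt s (t * u)) := by
  rw [lt, lt, mul_inv_rev, P.mul_lact, P.lact_lact_inv]

lemma lt_ract (s t u : Γ) : B.lt (P.ract s (B.ψ t)) u = B.lt s (t * u) := by
  rw [lt, lt, map_inv, ← B.lact_φ, inv_inv, mul_inv_rev, P.mul_lact]

end BraidingHoms

section Crossed

variable (k : Type w) [Field k] {G Γ : Type*} [Group G] [Group Γ] [Fintype Γ]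
  (P : MatchedPair G Γ) (C : Type u) [Category.{v} C] [Preadditive C] [Linear k C]
  [MonoidalCategory C] [MonoidalPreadditive C] [MonoidalLinear k C] [TensorCategory k C]

/-- A `(G, Γ)`-crossed action on the tensor category `C`. The category `C` is not assumed to be
strict, so associators and unitors appear in the axioms; `tr` is the identification of `ρ^a` with
`ρ^b` for `a = b`. -/
structure CrossedAction extends RightAction k G C, Grading Γ C where
  map_deg : ∀ (g : G) (s : Γ), (deg s).map (ρ g) = deg (P.ract s g)
  γ : ∀ (g : G) {t : Γ} (X : C) {Y : C}, deg t Y →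
    ((ρ g).obj (X ⊗ Y) ≅ (ρ (P.lact t g)).obj X ⊗ (ρ g).obj Y)
  γ_natural : ∀ (g : G) {t : Γ} {X X' Y Y' : C} (hY : deg t Y) (hY' : deg t Y')
    (f : X ⟶ X') (f' : Y ⟶ Y'),
    (ρ g).map (f ⊗ₘ f') ≫ (γ g X' hY').hom =
      (γ g X hY).hom ≫ ((ρ (P.lact t g)).map f ⊗ₘ (ρ g).map f')
  γ₀ : ∀ g : G, (ρ g).obj (𝟙_ C) ≅ 𝟙_ C
  γ_assoc : ∀ (g : G) {s t : Γ} (X : C) {Y Z : C} (hY : deg s Y) (hZ : deg t Z),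
    (γ g (X ⊗ Y) hZ).hom ≫ (γ (P.lact t g) X hY).hom ▷ (ρ g).obj Z ≫ (α_ _ _ _).hom =
      (ρ g).map (α_ X Y Z).hom ≫ (γ g X (tensor_mem hY hZ)).hom ≫
        (toRightAction.tr (P.mul_lact s t g) X ⊗ₘ (γ g Y hZ).hom)
  γ_unit_right : ∀ (g : G) (X : C),
    (γ g X (toGrading.unit_mem k)).hom ≫ (toRightAction.tr (P.one_lact g) X ⊗ₘ (γ₀ g).hom) ≫
      (ρ_ ((ρ g).obj X)).hom = (ρ g).map (ρ_ X).hom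
  γ_unit_left : ∀ (g : G) {t : Γ} {X : C} (hX : deg t X),
    (γ g (𝟙_ C) hX).hom ≫ (γ₀ (P.lact t g)).hom ▷ (ρ g).obj X ≫ (λ_ ((ρ g).obj X)).hom =
      (ρ g).map (λ_ X).hom
  γ_mul : ∀ (g h : G) {s : Γ} (X : C) {Y : C} (hY : deg s Y),
    (ρ₂ g h).hom.app (X ⊗ Y) ≫ (γ (h * g) X hY).hom ≫
        toRightAction.tr (P.lact_mul s h g) X ▷ (ρ (h * g)).obj Y =
      (ρ g).map (γ h X hY).hom ≫ (γ g ((ρ (P.lact s h)).obj X)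
          ((map_deg h s).le _ ((deg s).prop_map_obj (ρ h) hY))).hom ≫
        ((ρ₂ (P.lact (P.ract s h) g) (P.lact s h)).hom.app X ⊗ₘ (ρ₂ g h).hom.app Y)
  γ₀_mul : ∀ g h : G,
    (ρ₂ g h).hom.app (𝟙_ C) ≫ (γ₀ (h * g)).hom = (ρ g).map (γ₀ h).hom ≫ (γ₀ g).hom
  γ_one : ∀ {s : Γ} (X : C) {Y : C} (hY : deg s Y),
    ρ₀.hom.app (X ⊗ Y) ≫ (γ 1 X hY).hom ≫
        toRightAction.tr (P.lact_one s) X ▷ (ρ 1).obj Y =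
      (ρ₀.hom.app X ⊗ₘ ρ₀.hom.app Y)
  γ₀_one : ρ₀.hom.app (𝟙_ C) ≫ (γ₀ 1).hom = 𝟙 (𝟙_ C)

end Crossed

namespace CrossedAction

variable {k : Type w} [Field k] {G Γ : Type*} [Group G] [Group Γ] [Fintype Γ]
  {P : MatchedPair G Γ} {C : Type u} [Category.{v} C] [Preadditive C] [Linear k C]
  [MonoidalCategory C] [MonoidalPreadditive C] [MonoidalLinear k C] [TensorCategory k C]
  (A : CrossedAction k P C)

lemma map_mem (g : G) {s : Γ} {X : C} (hX : A.deg s X) :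
    A.deg (P.ract s g) ((A.ρ g).obj X) := by
  rw [← A.map_deg]
  exact ObjectProperty.prop_map_obj _ _ hX

/-- The naturality of `γ` in its first variable. -/
lemma γ_natural_left (g : G) {t : Γ} {X X' Y : C} (hY : A.deg t Y) (f : X ⟶ X') :
    (A.ρ g).map (f ▷ Y) ≫ (A.γ g X' hY).hom =
      (A.γ g X hY).hom ≫ (A.ρ (P.lact t g)).map f ▷ (A.ρ g).obj Y := by
  have h := A.γ_natural g hY hY f (𝟙 Y)
  rwa [tensorHom_id, CategoryTheory.Functor.map_id, tensorHom_id] at h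

/-- The naturality of `γ` in its second variable. -/
lemma γ_natural_right (g : G) {t : Γ} (X : C) {Y Y' : C} (hY : A.deg t Y) (hY' : A.deg t Y')
    (f : Y ⟶ Y') :
    (A.ρ g).map (X ◁ f) ≫ (A.γ g X hY').hom =
      (A.γ g X hY).hom ≫ (A.ρ (P.lact t g)).obj X ◁ (A.ρ g).map f := by
  have h := A.γ_natural g hY hY' (𝟙 X) f
  rwa [id_tensorHom, CategoryTheory.Functor.map_id, id_tensorHom] at h

/-- The category `C^{(G, Γ)}`, whose underlying `k`-linear category is the equivariantization. -/
abbrev Equivariantization := A.toRightAction.EquivariantObject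

variable {A}

/-- The action `r̃^g` on `X ⊗ Y`: on the summand `ρ^g(X ⊗ Y_s)` of `ρ^g(X ⊗ Y)` it is the
composition of `γ^g_{X, Y_s}` and `r^{s ▷ g} ⊗ r'^g`. -/
def tensorR (X Y : A.Equivariantization) (g : G) :
    (A.ρ g).obj (X.obj ⊗ Y.obj) ⟶ X.obj ⊗ Y.obj :=
  ∑ s : Γ, (A.ρ g).map (X.obj ◁ (A.decomp Y.obj).π s) ≫
    (A.γ g X.obj ((A.decomp Y.obj).mem s)).hom ≫
      (X.r (P.lact s g) ⊗ₘ ((A.ρ g).map ((A.decomp Y.obj).ι s) ≫ Y.r g))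

lemma map_tensorR (X Y : A.Equivariantization) (g : G) {s : Γ} {Z : C} (hZ : A.deg s Z)
    (f : Z ⟶ Y.obj) :
    (A.ρ g).map (X.obj ◁ f) ≫ tensorR X Y g =
      (A.γ g X.obj hZ).hom ≫ (X.r (P.lact s g) ⊗ₘ ((A.ρ g).map f ≫ Y.r g)) := by
  have hf : f = (f ≫ (A.decomp Y.obj).π s) ≫ (A.decomp Y.obj).ι s := by
    conv_lhs => rw [← Category.comp_id f, ← (A.decomp Y.obj).sum_π_ι, Preadditive.comp_sum]
    rw [Finset.sum_eq_single s, Category.assoc]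
    · intro t _ ht
      rw [← Category.assoc, A.hom_eq_zero hZ ((A.decomp Y.obj).mem t) ht.symm (f ≫ _), zero_comp]
    · intro h; exact absurd (Finset.mem_univ s) h
  rw [tensorR, Preadditive.comp_sum, Finset.sum_eq_single s]
  · rw [← Functor.map_comp_assoc, ← MonoidalCategory.whiskerLeft_comp,
      reassoc_of% (A.γ_natural_right g X.obj hZ ((A.decomp Y.obj).mem s))]
    congr 1
    rw [← id_tensorHom, tensorHom_comp_tensorHom, Category.id_comp, ← Functor.map_comp_assoc, ← hf]
  · intro t _ ht
    rw [← Functor.map_comp_assoc, ← MonoidalCategory.whiskerLeft_comp,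
      A.hom_eq_zero hZ ((A.decomp Y.obj).mem t) ht.symm (f ≫ _)]
    simp
  · intro h; exact absurd (Finset.mem_univ s) h

lemma tensorR_mul (X Y : A.Equivariantization) (g h : G) :
    (A.ρ g).map (tensorR X Y h) ≫ tensorR X Y g =
      (A.ρ₂ g h).hom.app (X.obj ⊗ Y.obj) ≫ tensorR X Y (h * g) := by
  apply (A.decomp Y.obj).hom_ext (tensorLeft X.obj ⋙ A.ρ h ⋙ A.ρ g)
  intro s
  set D := A.decomp Y.obj
  have hs := D.mem s
  have hs' := A.map_mem h hs
  have e1 : (A.ρ g).map ((A.ρ h).map (X.obj ◁ D.ι s)) ≫ (A.ρ g).map (tensorR X Y h) ≫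
      tensorR X Y g = (A.ρ g).map (A.γ h X.obj hs).hom ≫
        (A.γ g ((A.ρ (P.lact s h)).obj X.obj) hs').hom ≫
          (((A.ρ (P.lact (P.ract s h) g)).map (X.r (P.lact s h)) ≫
              X.r (P.lact (P.ract s h) g)) ⊗ₘ
            ((A.ρ g).map ((A.ρ h).map (D.ι s) ≫ Y.r h) ≫ Y.r g)) := by
    rw [← Functor.map_comp_assoc, map_tensorR X Y h hs, MonoidalCategory.tensorHom_def, Functor.map_comp,
      Functor.map_comp, Category.assoc, Category.assoc, map_tensorR X Y g hs',
      reassoc_of% (A.γ_natural_left g hs')]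
    congr 2
    rw [← tensorHom_id, tensorHom_comp_tensorHom, Category.id_comp]
  have e2 : (A.ρ g).map ((A.ρ h).map (X.obj ◁ D.ι s)) ≫
      (A.ρ₂ g h).hom.app (X.obj ⊗ Y.obj) ≫ tensorR X Y (h * g) =
        (A.ρ₂ g h).hom.app (X.obj ⊗ D.comp s) ≫ (A.γ (h * g) X.obj hs).hom ≫
          (X.r (P.lact s (h * g)) ⊗ₘ ((A.ρ (h * g)).map (D.ι s) ≫ Y.r (h * g))) := by
    have := (A.ρ₂ g h).hom.naturality (X.obj ◁ D.ι s)
    dsimp at this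
    rw [reassoc_of% this, map_tensorR X Y (h * g) hs]
  dsimp
  rw [e1, e2, X.r_mul, Functor.map_comp, Category.assoc, Y.r_mul]
  have hn := (A.ρ₂ g h).hom.naturality (D.ι s)
  dsimp at hn
  rw [reassoc_of% hn, ← tensorHom_comp_tensorHom,
    ← reassoc_of% (A.γ_mul g h X.obj hs), ← tensorHom_id, tensorHom_comp_tensorHom,
    X.tr_r, Category.id_comp]

lemma tensorR_one (X Y : A.Equivariantization) :
    A.ρ₀.hom.app (X.obj ⊗ Y.obj) ≫ tensorR X Y 1 = 𝟙 _ := by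
  apply (A.decomp Y.obj).hom_ext (tensorLeft X.obj)
  intro s
  set D := A.decomp Y.obj
  have h := A.ρ₀.hom.naturality (X.obj ◁ D.ι s)
  dsimp at h ⊢
  have hn := A.ρ₀.hom.naturality (D.ι s)
  dsimp at hn
  rw [reassoc_of% h, map_tensorR X Y 1 (D.mem s), ← X.tr_r (P.lact_one s),
    ← Category.id_comp ((A.ρ 1).map (D.ι s) ≫ _), ← tensorHom_comp_tensorHom, tensorHom_id,
    reassoc_of% (A.γ_one X.obj (D.mem s)), tensorHom_comp_tensorHom, X.r_one, ← reassoc_of% hn,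
    Y.r_one]
  simp

/-- The tensor product `(X, r) ⊗ (Y, r') = (X ⊗ Y, r̃)`. -/
abbrev tensorObj (X Y : A.Equivariantization) : A.Equivariantization where
  obj := X.obj ⊗ Y.obj
  r := tensorR X Y
  isIso_r := A.isIso_of_mul_one _ (tensorR_mul X Y) (tensorR_one X Y)
  r_mul := tensorR_mul X Y
  r_one := tensorR_one X Y

variable (A) in
/-- The unit object `(𝟙, γ₀)`. -/
abbrev tensorUnit : A.Equivariantization where
  obj := 𝟙_ C
  r g := (A.γ₀ g).hom
  isIso_r _ := inferInstance
  r_mul g h := (A.γ₀_mul g h).symm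
  r_one := A.γ₀_one

lemma tensorR_naturality {X X' Y Y' : A.Equivariantization} (f : X ⟶ X') (f' : Y ⟶ Y') (g : G) :
    tensorR X Y g ≫ (f.hom ⊗ₘ f'.hom) = (A.ρ g).map (f.hom ⊗ₘ f'.hom) ≫ tensorR X' Y' g := by
  apply (A.decomp Y.obj).hom_ext (tensorLeft X.obj ⋙ A.ρ g)
  intro s
  set D := A.decomp Y.obj
  have hs := D.mem s
  have e : X.obj ◁ D.ι s ≫ (f.hom ⊗ₘ f'.hom) =
      f.hom ▷ D.comp s ≫ X'.obj ◁ (D.ι s ≫ f'.hom) := by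
    rw [← id_tensorHom, ← tensorHom_id, ← id_tensorHom, tensorHom_comp_tensorHom,
      tensorHom_comp_tensorHom]
    simp
  dsimp
  rw [← Functor.map_comp_assoc, e, Functor.map_comp, Category.assoc, map_tensorR X' Y' g hs,
    reassoc_of% (A.γ_natural_left g hs), reassoc_of% (map_tensorR X Y g hs)]
  congr 1
  rw [← tensorHom_id, tensorHom_comp_tensorHom, tensorHom_comp_tensorHom, f.comm, Category.assoc,
    f'.comm, Functor.map_comp, Category.id_comp, Category.assoc]

lemma tensorR_associator (X Y Z : A.Equivariantization) (g : G) :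
    tensorR (tensorObj X Y) Z g ≫ (α_ X.obj Y.obj Z.obj).hom =
      (A.ρ g).map (α_ X.obj Y.obj Z.obj).hom ≫ tensorR X (tensorObj Y Z) g := by
  apply (A.decomp Z.obj).hom_ext (tensorLeft (X.obj ⊗ Y.obj) ⋙ A.ρ g)
  intro t
  set D := A.decomp Z.obj
  have ht := D.mem t
  apply (A.decomp Y.obj).hom_ext (tensorLeft X.obj ⋙ tensorRight (D.comp t) ⋙ A.ρ g)
  intro s
  set D' := A.decomp Y.obj
  have hs := D'.mem s
  have e1 := map_tensorR (tensorObj X Y) Z g ht (D.ι t)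
  have e2 := map_tensorR X (tensorObj Y Z) g (A.tensor_mem hs ht) (D'.ι s ⊗ₘ D.ι t)
  have e3 : (X.obj ◁ D'.ι s) ▷ D.comp t ≫ (X.obj ⊗ Y.obj) ◁ D.ι t ≫
      (α_ X.obj Y.obj Z.obj).hom = (α_ _ _ _).hom ≫ X.obj ◁ (D'.ι s ⊗ₘ D.ι t) := by
    simp [MonoidalCategory.tensorHom_def]
  have e4 : (A.ρ g).map (D'.ι s ⊗ₘ D.ι t) ≫ tensorR Y Z g = (A.γ g (D'.comp s) ht).hom ≫
      (((A.ρ (P.lact t g)).map (D'.ι s) ≫ Y.r (P.lact t g)) ⊗ₘ ((A.ρ g).map (D.ι t) ≫ Z.r g)) := by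
    rw [MonoidalCategory.tensorHom_def, Functor.map_comp, Category.assoc, map_tensorR Y Z g ht,
      reassoc_of% (A.γ_natural_left g ht), ← tensorHom_id, tensorHom_comp_tensorHom,
      Category.id_comp]
  dsimp at e1 e2 ⊢
  rw [e4] at e2
  rw [reassoc_of% e1, ← Functor.map_comp_assoc, ← Functor.map_comp_assoc, Category.assoc, e3,
    Functor.map_comp, Category.assoc, e2, reassoc_of% (A.γ_natural_left g ht)]
  rw [← X.tr_r (P.mul_lact s t g), ← tensorHom_comp_tensorHom,
    ← reassoc_of% (A.γ_assoc g X.obj hs ht)]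
  congr 1
  rw [← associator_naturality, ← tensorHom_id, ← tensorHom_id, tensorHom_comp_tensorHom_assoc,
    tensorHom_comp_tensorHom_assoc, map_tensorR X Y (P.lact t g) hs]

lemma tensorR_leftUnitor (X : A.Equivariantization) (g : G) :
    tensorR (tensorUnit A) X g ≫ (λ_ X.obj).hom = (A.ρ g).map (λ_ X.obj).hom ≫ X.r g := by
  apply (A.decomp X.obj).hom_ext (tensorLeft (𝟙_ C) ⋙ A.ρ g)
  intro s
  set D := A.decomp X.obj
  have e := map_tensorR (tensorUnit A) X g (D.mem s) (D.ι s)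
  dsimp at e ⊢
  rw [reassoc_of% e, ← Functor.map_comp_assoc, leftUnitor_naturality, Functor.map_comp,
    Category.assoc, ← A.γ_unit_left g (D.mem s), MonoidalCategory.tensorHom_def]
  simp

lemma tensorR_rightUnitor (X : A.Equivariantization) (g : G) :
    tensorR X (tensorUnit A) g ≫ (ρ_ X.obj).hom = (A.ρ g).map (ρ_ X.obj).hom ≫ X.r g := by
  have e := map_tensorR X (tensorUnit A) g (A.unit_mem k) (𝟙 _)
  have e' := A.γ_unit_right g X.obj
  dsimp at e
  rw [MonoidalCategory.whiskerLeft_id, CategoryTheory.Functor.map_id, CategoryTheory.Functor.map_id, Category.id_comp,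
    Category.id_comp] at e
  rw [e, ← e', ← X.tr_r (P.one_lact g), Category.assoc, Category.assoc, Category.assoc,
    ← rightUnitor_naturality, ← tensorHom_id, tensorHom_comp_tensorHom_assoc, Category.comp_id]

instance : MonoidalCategoryStruct A.Equivariantization where
  tensorObj := tensorObj
  tensorUnit := tensorUnit A
  tensorHom f f' := ⟨f.hom ⊗ₘ f'.hom, tensorR_naturality f f'⟩
  whiskerLeft X _ _ f := ⟨X.obj ◁ f.hom, by
    have := tensorR_naturality (𝟙 X) f
    rwa [RightAction.EquivariantObject.id_hom, id_tensorHom] at this⟩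
  whiskerRight f X := ⟨f.hom ▷ X.obj, by
    have := tensorR_naturality f (𝟙 X)
    rwa [RightAction.EquivariantObject.id_hom, tensorHom_id] at this⟩
  associator X Y Z := RightAction.EquivariantObject.mkIso (α_ X.obj Y.obj Z.obj)
    (tensorR_associator X Y Z)
  leftUnitor X := RightAction.EquivariantObject.mkIso (λ_ X.obj) (tensorR_leftUnitor X)
  rightUnitor X := RightAction.EquivariantObject.mkIso (ρ_ X.obj) (tensorR_rightUnitor X)

section

variable {X X' Y Y' Z : A.Equivariantization}

@[simp]
lemma tensor_obj : (X ⊗ Y).obj = X.obj ⊗ Y.obj := rfl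

@[simp]
lemma unit_obj : (𝟙_ A.Equivariantization).obj = 𝟙_ C := rfl

@[simp]
lemma tensorHom_hom (f : X ⟶ X') (f' : Y ⟶ Y') : (f ⊗ₘ f').hom = f.hom ⊗ₘ f'.hom := rfl

@[simp]
lemma whiskerLeft_hom (f : Y ⟶ Y') : (X ◁ f).hom = X.obj ◁ f.hom := rfl

@[simp]
lemma whiskerRight_hom (f : X ⟶ X') : (f ▷ Y).hom = f.hom ▷ Y.obj := rfl

@[simp]
lemma associator_hom_hom : (α_ X Y Z).hom.hom = (α_ X.obj Y.obj Z.obj).hom := rfl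

@[simp]
lemma associator_inv_hom : (α_ X Y Z).inv.hom = (α_ X.obj Y.obj Z.obj).inv := rfl

@[simp]
lemma leftUnitor_hom_hom : (λ_ X).hom.hom = (λ_ X.obj).hom := rfl

@[simp]
lemma leftUnitor_inv_hom : (λ_ X).inv.hom = (λ_ X.obj).inv := rfl

@[simp]
lemma rightUnitor_hom_hom : (ρ_ X).hom.hom = (ρ_ X.obj).hom := rfl

@[simp]
lemma rightUnitor_inv_hom : (ρ_ X).inv.hom = (ρ_ X.obj).inv := rfl

end

/-- The monoidal category `C^{(G, Γ)}`. -/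
instance : MonoidalCategory A.Equivariantization where
  tensorHom_def f g := by ext; simp [MonoidalCategory.tensorHom_def]
  id_tensorHom_id X Y := by ext; simp
  tensorHom_comp_tensorHom f₁ f₂ g₁ g₂ := by ext; simp
  whiskerLeft_id X Y := by ext; simp
  id_whiskerRight X Y := by ext; simp
  associator_naturality f₁ f₂ f₃ := by ext; simp
  leftUnitor_naturality f := by ext; simp
  rightUnitor_naturality f := by ext; simp
  pentagon W X Y Z := by ext; simp
  triangle X Y := by ext; simp

instance : MonoidalPreadditive A.Equivariantization where
  whiskerLeft_zero := RightAction.EquivariantObject.hom_ext MonoidalPreadditive.whiskerLeft_zero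
  zero_whiskerRight := RightAction.EquivariantObject.hom_ext MonoidalPreadditive.zero_whiskerRight
  whiskerLeft_add f g :=
    RightAction.EquivariantObject.hom_ext (MonoidalPreadditive.whiskerLeft_add f.hom g.hom)
  add_whiskerRight f g :=
    RightAction.EquivariantObject.hom_ext (MonoidalPreadditive.add_whiskerRight f.hom g.hom)

instance : MonoidalLinear k A.Equivariantization where
  whiskerLeft_smul X _ _ a f :=
    RightAction.EquivariantObject.hom_ext (MonoidalLinear.whiskerLeft_smul X.obj a f.hom)
  smul_whiskerRight a _ _ f X :=
    RightAction.EquivariantObject.hom_ext (MonoidalLinear.smul_whiskerRight a f.hom X.obj)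

variable (A) in
/-- A `(G, Γ)`-crossed braiding `(c, φ, ψ)` in the `(G, Γ)`-crossed tensor category `C`. -/
structure CrossedBraiding extends BraidingHoms P where
  c : ∀ {s t : Γ} {X Y : C}, A.deg s X → A.deg t Y →
    (X ⊗ Y ≅ (A.ρ (P.lact t⁻¹ (φ s⁻¹))).obj Y ⊗ (A.ρ (ψ t)).obj X)
  c_natural : ∀ {s t : Γ} {X X' Y Y' : C} (hX : A.deg s X) (hX' : A.deg s X')
    (hY : A.deg t Y) (hY' : A.deg t Y') (f : X ⟶ X') (f' : Y ⟶ Y'),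
    (f ⊗ₘ f') ≫ (c hX' hY').hom =
      (c hX hY).hom ≫ ((A.ρ (P.lact t⁻¹ (φ s⁻¹))).map f' ⊗ₘ (A.ρ (ψ t)).map f)
  c_equivariant : ∀ (g : G) {s t : Γ} {X Y : C} (hX : A.deg s X) (hY : A.deg t Y),
    (A.γ g X hY).hom ≫ (c (A.map_mem (P.lact t g) hX) (A.map_mem g hY)).hom ≫
        ((A.ρ₂ (toBraidingHoms.lt (P.ract s (P.lact t g)) (P.ract t g)) g).hom.app Y ⊗ₘ
          (A.ρ₂ (ψ (P.ract t g)) (P.lact t g)).hom.app X) ≫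
        (A.tr (toBraidingHoms.mul_lt s t g) Y ⊗ₘ A.tr (ψ_mul t g).symm X) =
      (A.ρ g).map (c hX hY).hom ≫
        (A.γ g ((A.ρ (toBraidingHoms.lt s t)).obj Y) (A.map_mem (ψ t) hX)).hom ≫
        ((A.ρ₂ (P.lact (P.ract s (ψ t)) g) (toBraidingHoms.lt s t)).hom.app Y ⊗ₘ
          (A.ρ₂ g (ψ t)).hom.app X)
  c_tensor_left : ∀ {s t u : Γ} {X Y Z : C} (hX : A.deg s X) (hY : A.deg t Y) (hZ : A.deg u Z),
    (α_ X Y Z).inv ≫ (c (A.tensor_mem hX hY) hZ).hom ≫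
        (A.ρ (toBraidingHoms.lt (s * t) u)).obj Z ◁ (A.γ (ψ u) X hY).hom =
      X ◁ (c hY hZ).hom ≫ (α_ _ _ _).inv ≫
        (c hX (A.map_mem (toBraidingHoms.lt t u) hZ)).hom ▷ (A.ρ (ψ u)).obj Y ≫
        (α_ _ _ _).hom ≫
        (((A.ρ₂ (toBraidingHoms.lt s (P.ract u (toBraidingHoms.lt t u)))
              (toBraidingHoms.lt t u)).hom.app Z ≫ A.tr (toBraidingHoms.lt_mul_lt s t u) Z) ⊗ₘ
          A.tr (toBraidingHoms.ψ_ract_lt t u) X ▷ (A.ρ (ψ u)).obj Y)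
  c_tensor_right : ∀ {s t u : Γ} {X Y Z : C} (hX : A.deg s X) (hY : A.deg t Y) (hZ : A.deg u Z),
    (α_ X Y Z).hom ≫ (c hX (A.tensor_mem hY hZ)).hom ≫
        (A.γ (toBraidingHoms.lt s (t * u)) Y hZ).hom ▷ (A.ρ (ψ (t * u))).obj X ≫
        (α_ _ _ _).hom =
      (c hX hY).hom ▷ Z ≫ (α_ _ _ _).hom ≫
        (A.ρ (toBraidingHoms.lt s t)).obj Y ◁ (c (A.map_mem (ψ t) hX) hZ).hom ≫
        (A.tr (toBraidingHoms.lt_eq s t u) Y ⊗ₘ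
          (A.tr (toBraidingHoms.lt_ract s t u) Z ⊗ₘ
            ((A.ρ₂ (ψ u) (ψ t)).hom.app X ≫ A.tr (ψ.map_mul t u).symm X)))

/-- The component `r^g_s : ρ^g(X_s) → X_{s ◁ g}` of `r^g` with respect to a decomposition of `X` into
homogeneous objects. -/
def rComp (X : A.Equivariantization) (D : A.Decomposition X.obj) (g : G) (s : Γ) :
    (A.ρ g).obj (D.comp s) ⟶ D.comp (P.ract s g) :=
  (A.ρ g).map (D.ι s) ≫ X.r g ≫ D.π (P.ract s g)

/-- The morphism `(l^{t⁻¹ ▷ φ(s⁻¹)} ⊗ r^{ψ(t)}) c_{X_s, Y_t}`. -/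
def CrossedBraiding.braidingComp (B : A.CrossedBraiding) (X Y : A.Equivariantization)
    (D : A.Decomposition X.obj) (E : A.Decomposition Y.obj) (s t : Γ) :
    D.comp s ⊗ E.comp t ⟶
      E.comp (P.ract t (P.lact t⁻¹ (B.φ s⁻¹))) ⊗ D.comp (P.ract s (B.ψ t)) :=
  (B.c (D.mem s) (E.mem t)).hom ≫
    (rComp Y E (P.lact t⁻¹ (B.φ s⁻¹)) t ⊗ₘ rComp X D (B.ψ t) s)

end CrossedAction

end

/-! The abelian structure descends from `C` because each `ρ^g` is an equivalence: kernels and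
cokernels formed in `C` inherit an action, and a factorisation through an equivariant map that is
mono or epi in `C` is automatically equivariant. Normality of monomorphisms and epimorphisms is
therefore that of `C`. Equivariant subobjects embed into the subobjects of the underlying object,
which gives finite length, and the unit stays simple.

For the monoidal part, an action on `X` is read as a rule that sends `f : U ⟶ X` to its translate
`ρ^g(U) ⟶ X` (`act`). The braiding is pinned down on arbitrary morphisms from homogeneous objects
`U`, `V`: it is `c_{U,V}` followed by translates (`tensorHom_braidingHom`). This removes all
dependence on chosen decompositions. Axioms 1, 2, 3 composed with translates then become
equivariance and the two hexagons, since `act_act` and `tr_act` absorb every `ρ₂` and every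
identification of equal group elements. The braiding moves the summand `X_s ⊗ Y_t` to another pair
of degrees. It is invertible because this move is a permutation of `Γ × Γ` (`degreeEquiv`) and each
block is an isomorphism.

For rigidity, let `Y` be a right dual of `X` in `C`. A map `ρ^a(Y) ⟶ Y` is the same as a pairing
`ρ^a(Y) ⊗ X ⟶ 𝟙`. On `X_s` this pairing is the image of the evaluation under `ρ^g`, where `s ▷ g =
a` (`dualPairing`). The coherence of `γ` and `γ₀` makes this an action for which the evaluation is
equivariant, and the zigzag identity forces the coevaluation to be equivariant too. The braiding
turns these right duals into left duals. -/

noncomputable section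

/-! ### The functors `ρ^g` and the construction of equivariant objects. -/

namespace RightAction

variable {k : Type w} [Field k] {G : Type*} [Group G] {C : Type u} [Category.{v} C]

section Preadditive

variable [Preadditive C] [Linear k C] (A : RightAction k G C)

/-- The functors `ρ^{g⁻¹}` and `ρ^g` are mutually inverse up to isomorphism. -/
def invCompIso (g : G) : A.ρ g⁻¹ ⋙ A.ρ g ≅ 𝟭 C :=
  A.ρ₂ g g⁻¹ ≪≫ eqToIso (by rw [inv_mul_cancel]) ≪≫ A.ρ₀.symm

/-- The functors `ρ^g` and `ρ^{g⁻¹}` are mutually inverse up to isomorphism. -/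
def compInvIso (g : G) : A.ρ g ⋙ A.ρ g⁻¹ ≅ 𝟭 C :=
  A.ρ₂ g⁻¹ g ≪≫ eqToIso (by rw [mul_inv_cancel]) ≪≫ A.ρ₀.symm

/-- Each of `ρ^g`, `ρ^{g⁻¹}` is inverse to the other up to `ρ₂` and `ρ₀`. This is what makes `ρ^g`
preserve cokernels. -/
instance isEquivalence_ρ (g : G) : (A.ρ g).IsEquivalence where
  faithful := A.faithful g
  full :=
    have := A.faithful g⁻¹
    Functor.Full.of_comp_faithful_iso (A.compInvIso g)
  essSurj := ⟨fun X => ⟨_, ⟨(A.invCompIso g).app X⟩⟩⟩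

variable {A}

namespace EquivariantObject

/-- An equivariant object from a family of maps `r`, whose invertibility is automatic. -/
@[simps]
def ofMulOne (X : C) (r : ∀ g : G, (A.ρ g).obj X ⟶ X)
    (mul : ∀ g h : G, (A.ρ g).map (r h) ≫ r g = (A.ρ₂ g h).hom.app X ≫ r (h * g))
    (one : A.ρ₀.hom.app X ≫ r 1 = 𝟙 X) : A.EquivariantObject where
  obj := X
  r := r
  isIso_r := A.isIso_of_mul_one r mul one
  r_mul := mul
  r_one := one

lemma ρ₂_naturality (g h : G) {X Y : C} (f : X ⟶ Y) :
    (A.ρ g).map ((A.ρ h).map f) ≫ (A.ρ₂ g h).hom.app Y =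
      (A.ρ₂ g h).hom.app X ≫ (A.ρ (h * g)).map f :=
  (A.ρ₂ g h).hom.naturality f

lemma ρ₀_naturality {X Y : C} (f : X ⟶ Y) :
    f ≫ A.ρ₀.hom.app Y = A.ρ₀.hom.app X ≫ (A.ρ 1).map f :=
  A.ρ₀.hom.naturality f

/-- The structure of an equivariant object on a subobject that is stable under the action. -/
def ofMono (Y : A.EquivariantObject) {X : C} (i : X ⟶ Y.obj) [Mono i]
    (r : ∀ g : G, (A.ρ g).obj X ⟶ X) (hr : ∀ g, r g ≫ i = (A.ρ g).map i ≫ Y.r g) :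
    A.EquivariantObject :=
  ofMulOne X r
    (fun g h => by
      rw [← cancel_mono i, Category.assoc, Category.assoc, hr, hr, ← Functor.map_comp_assoc, hr,
        Functor.map_comp, Category.assoc, Y.r_mul, reassoc_of% (ρ₂_naturality (A := A) g h i)])
    (by
      rw [← cancel_mono i, Category.assoc, hr, ← reassoc_of% (ρ₀_naturality (A := A) i), Y.r_one]
      simp)

/-- The structure of an equivariant object on a quotient that is compatible with the action. -/
def ofEpi (X : A.EquivariantObject) {Y : C} (p : X.obj ⟶ Y) [Epi p]
    (r : ∀ g : G, (A.ρ g).obj Y ⟶ Y) (hr : ∀ g, (A.ρ g).map p ≫ r g = X.r g ≫ p) :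
    A.EquivariantObject :=
  ofMulOne Y r
    (fun g h => by
      rw [← cancel_epi ((A.ρ g).map ((A.ρ h).map p)), ← Functor.map_comp_assoc, hr,
        reassoc_of% (ρ₂_naturality (A := A) g h p), hr, Functor.map_comp, Category.assoc, hr,
        reassoc_of% (X.r_mul g h)])
    (by
      rw [← cancel_epi p, reassoc_of% (ρ₀_naturality (A := A) p), hr, reassoc_of% X.r_one,
        Category.comp_id])

variable (A) in
/-- The functor that forgets the action. -/
@[simps]
def forget : A.EquivariantObject ⥤ C where
  obj X := X.obj
  map f := f.hom

instance finiteDimensional_hom (X Y : A.EquivariantObject) [FiniteDimensional k (X.obj ⟶ Y.obj)] :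
    FiniteDimensional k (X ⟶ Y) :=
  Module.Finite.equiv
    (⟨⟨⟨homEquiv X Y, fun _ _ => rfl⟩, fun _ _ => rfl⟩, (homEquiv X Y).symm, fun _ => rfl,
      fun _ => rfl⟩ : (X ⟶ Y) ≃ₗ[k] homSubmodule X Y).symm

end EquivariantObject

end Preadditive

/-! ### The equivariantization is abelian. -/

namespace EquivariantObject

variable [Abelian C] [Linear k C] {A : RightAction k G C}

/-- The direct sum of two equivariant objects. -/
def biprod (X Y : A.EquivariantObject) : A.EquivariantObject :=
  ofMulOne (X.obj ⊞ Y.obj)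
    (fun g => biprod.lift ((A.ρ g).map biprod.fst ≫ X.r g) ((A.ρ g).map biprod.snd ≫ Y.r g))
    (fun g h => by
      ext
      · simp only [Category.assoc, biprod.lift_fst, ← Functor.map_comp_assoc]
        simp only [Functor.map_comp, Category.assoc, X.r_mul,
          reassoc_of% (ρ₂_naturality (A := A) g h)]
      · simp only [Category.assoc, biprod.lift_snd, ← Functor.map_comp_assoc]
        simp only [Functor.map_comp, Category.assoc, Y.r_mul,
          reassoc_of% (ρ₂_naturality (A := A) g h)])
    (by
      ext
      · rw [Category.assoc, biprod.lift_fst,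
          ← reassoc_of% (ρ₀_naturality (A := A) (biprod.fst : X.obj ⊞ Y.obj ⟶ _)), X.r_one]
        simp
      · rw [Category.assoc, biprod.lift_snd,
          ← reassoc_of% (ρ₀_naturality (A := A) (biprod.snd : X.obj ⊞ Y.obj ⟶ _)), Y.r_one]
        simp)

/-- The morphism to a direct sum given by its two components. -/
def biprodLift {T X Y : A.EquivariantObject} (f : T ⟶ X) (g : T ⟶ Y) : T ⟶ biprod X Y where
  hom := biprod.lift f.hom g.hom
  comm a := by
    change T.r a ≫ biprod.lift f.hom g.hom = (A.ρ a).map (biprod.lift f.hom g.hom) ≫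
      biprod.lift ((A.ρ a).map biprod.fst ≫ X.r a) ((A.ρ a).map biprod.snd ≫ Y.r a)
    ext
    · rw [Category.assoc, Category.assoc, biprod.lift_fst, biprod.lift_fst,
        ← Functor.map_comp_assoc, biprod.lift_fst, f.comm]
    · rw [Category.assoc, Category.assoc, biprod.lift_snd, biprod.lift_snd,
        ← Functor.map_comp_assoc, biprod.lift_snd, g.comm]

instance : HasBinaryProducts A.EquivariantObject := by
  have : ∀ {X Y : A.EquivariantObject}, HasLimit (pair X Y) := fun {X Y} => by
    refine ⟨⟨⟨BinaryFan.mk (P := biprod X Y) ⟨biprod.fst, fun g => biprod.lift_fst _ _⟩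
      ⟨biprod.snd, fun g => biprod.lift_snd _ _⟩,
      BinaryFan.IsLimit.mk _ (fun {T} f g => biprodLift f g)
        (fun f g => ?_) (fun f g => ?_) (fun f g m h₁ h₂ => ?_)⟩⟩⟩
    · exact hom_ext (biprod.lift_fst _ _)
    · exact hom_ext (biprod.lift_snd _ _)
    · apply hom_ext
      apply biprod.hom_ext
      · exact (congrArg Hom.hom h₁).trans (biprod.lift_fst _ _).symm
      · exact (congrArg Hom.hom h₂).trans (biprod.lift_snd _ _).symm
  exact hasBinaryProducts_of_hasLimit_pair _

open ZeroObject in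
instance : HasTerminal A.EquivariantObject := by
  let Z : A.EquivariantObject := ofMulOne (0 : C) (fun _ => 0)
    (fun _ _ => (isZero_zero C).eq_of_tgt _ _) ((isZero_zero C).eq_of_tgt _ _)
  have hZ : IsTerminal Z := IsTerminal.ofUniqueHom
    (fun X => (0 : X ⟶ Z)) (fun X f => hom_ext ((isZero_zero C).eq_of_tgt _ _))
  exact hZ.hasTerminal

instance : HasFiniteProducts A.EquivariantObject :=
  hasFiniteProducts_of_has_binary_and_terminal

section Kernel

variable {X Y : A.EquivariantObject} (f : X ⟶ Y)

/-- The kernel of an equivariant morphism. -/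
def kernel : A.EquivariantObject :=
  ofMono X (kernel.ι f.hom)
    (fun g => kernel.lift f.hom ((A.ρ g).map (kernel.ι f.hom) ≫ X.r g) (by
      rw [Category.assoc, f.comm, ← Functor.map_comp_assoc, kernel.condition, Functor.map_zero,
        zero_comp]))
    (fun g => kernel.lift_ι _ _ _)

/-- The inclusion of the kernel of an equivariant morphism. -/
def kernelι : kernel f ⟶ X := ⟨kernel.ι f.hom, fun _ => kernel.lift_ι _ _ _⟩

lemma kernelι_comp : kernelι f ≫ f = 0 := hom_ext (kernel.condition f.hom)

/-- Lifts along a monomorphism are equivariant. -/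
def liftOfMono {T : A.EquivariantObject} (h : T ⟶ Y) [Mono f.hom] (l : T.obj ⟶ X.obj)
    (hl : l ≫ f.hom = h.hom) : T ⟶ X :=
  ⟨l, fun g => by
    rw [← cancel_mono f.hom, Category.assoc, Category.assoc, hl, f.comm, ← Functor.map_comp_assoc,
      hl, h.comm]⟩

/-- Descents along an epimorphism are equivariant. -/
def descOfEpi {T : A.EquivariantObject} (h : X ⟶ T) [Epi f.hom] (l : Y.obj ⟶ T.obj)
    (hl : f.hom ≫ l = h.hom) : Y ⟶ T :=
  ⟨l, fun g => by
    rw [← cancel_epi ((A.ρ g).map f.hom), ← Functor.map_comp_assoc, hl, ← h.comm,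
      ← reassoc_of% (f.comm g), hl]⟩

instance : Mono (kernelι f).hom := inferInstanceAs (Mono (kernel.ι f.hom))

instance : HasKernels A.EquivariantObject where
  has_limit {X Y} f := ⟨⟨⟨KernelFork.ofι (kernelι f) (kernelι_comp f),
    KernelFork.IsLimit.ofι _ _
      (fun h w => liftOfMono (kernelι f) h (kernel.lift f.hom h.hom (congrArg Hom.hom w))
        (kernel.lift_ι _ _ _))
      (fun h w => hom_ext (kernel.lift_ι _ _ _))
      (fun h w m hm => hom_ext (by
        rw [← cancel_mono (kernelι f).hom]
        exact (congrArg Hom.hom hm).trans (kernel.lift_ι _ _ _).symm))⟩⟩⟩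

/-- The kernel taken in `C` is itself equivariant, so it is already seen, and killed, by a
monomorphism of `C^G`. This lets properties of monomorphisms be imported from `C`. -/
instance mono_hom [Mono f] : Mono f.hom := by
  apply Preadditive.mono_of_kernel_zero
  have h : kernelι f = 0 := by rw [← cancel_mono f, kernelι_comp, zero_comp]
  exact congrArg Hom.hom h

/-- Since `ρ^g` preserves cokernels, `ρ^g(coker f)` is a cokernel of `ρ^g(f)`, and equivariance of
`f` shows that the right-hand side kills `ρ^g(f)`. -/
lemma exists_cokernel_desc (g : G) : ∃ r : (A.ρ g).obj (cokernel f.hom) ⟶ cokernel f.hom,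
    (A.ρ g).map (cokernel.π f.hom) ≫ r = Y.r g ≫ cokernel.π f.hom := by
  have w : (A.ρ g).map f.hom ≫ Y.r g ≫ cokernel.π f.hom = 0 := by
    rw [← reassoc_of% (f.comm g), cokernel.condition, comp_zero]
  exact ⟨(PreservesCokernel.iso (A.ρ g) f.hom).hom ≫ cokernel.desc _ _ w, by simp⟩

/-- The cokernel of an equivariant morphism. -/
def cokernel : A.EquivariantObject :=
  ofEpi Y (cokernel.π f.hom) (fun g => (exists_cokernel_desc f g).choose)
    (fun g => (exists_cokernel_desc f g).choose_spec)

/-- The projection to the cokernel of an equivariant morphism. -/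
def cokernelπ : Y ⟶ cokernel f :=
  ⟨cokernel.π f.hom, fun g => ((exists_cokernel_desc f g).choose_spec).symm⟩

lemma comp_cokernelπ : f ≫ cokernelπ f = 0 := hom_ext (cokernel.condition f.hom)

instance : Epi (cokernelπ f).hom := inferInstanceAs (Epi (cokernel.π f.hom))

instance : HasCokernels A.EquivariantObject where
  has_colimit {X Y} f := ⟨⟨⟨CokernelCofork.ofπ (cokernelπ f) (comp_cokernelπ f),
    CokernelCofork.IsColimit.ofπ _ _
      (fun h w => descOfEpi (cokernelπ f) h (cokernel.desc f.hom h.hom (congrArg Hom.hom w))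
        (cokernel.π_desc _ _ _))
      (fun h w => hom_ext (cokernel.π_desc _ _ _))
      (fun h w m hm => hom_ext (by
        rw [← cancel_epi (cokernelπ f).hom]
        exact (congrArg Hom.hom hm).trans (cokernel.π_desc _ _ _).symm))⟩⟩⟩

instance epi_hom [Epi f] : Epi f.hom := by
  apply Preadditive.epi_of_cokernel_zero
  have h : cokernelπ f = 0 := by rw [← cancel_epi f, comp_cokernelπ, comp_zero]
  exact congrArg Hom.hom h

/-- A monomorphism is the kernel of its cokernel in `C`; the factorisations found there are
equivariant because they are unique. -/
instance : IsNormalMonoCategory A.EquivariantObject where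
  normalMonoOfMono {X Y} f _ := ⟨{
    Z := cokernel f
    g := cokernelπ f
    w := comp_cokernelπ f
    isLimit := KernelFork.IsLimit.ofι _ _
      (fun h w => liftOfMono f h (Abelian.monoLift f.hom h.hom (congrArg Hom.hom w))
        (Abelian.monoLift_comp _ _ _))
      (fun h w => hom_ext (Abelian.monoLift_comp _ _ _))
      (fun h w m hm => hom_ext (by
        rw [← cancel_mono f.hom]
        exact (congrArg Hom.hom hm).trans (Abelian.monoLift_comp _ _ _).symm)) }⟩

instance : IsNormalEpiCategory A.EquivariantObject where
  normalEpiOfEpi {X Y} f _ := ⟨{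
    W := kernel f
    g := kernelι f
    w := kernelι_comp f
    isColimit := CokernelCofork.IsColimit.ofπ _ _
      (fun h w => descOfEpi f h (Abelian.epiDesc f.hom h.hom (congrArg Hom.hom w))
        (Abelian.comp_epiDesc _ _ _))
      (fun h w => hom_ext (Abelian.comp_epiDesc _ _ _))
      (fun h w m hm => hom_ext (by
        rw [← cancel_epi f.hom]
        exact (congrArg Hom.hom hm).trans (Abelian.comp_epiDesc _ _ _).symm)) }⟩

lemma isIso_of_isIso_hom [IsIso f.hom] : IsIso f :=
  (mkIso (asIso f.hom) f.comm).isIso_hom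

end Kernel

/-! ### Finite length and simplicity. -/

section Subobject

variable (X : A.EquivariantObject)

/-- The subobject of the underlying object given by an equivariant subobject. -/
def subobjectForget (S : Subobject X) : Subobject X.obj := Subobject.mk S.arrow.hom

-- A factorisation of one equivariant inclusion through another in `C` is automatically equivariant,
-- so forgetting the action reflects the order.
variable {X} in
lemma subobjectForget_le_iff {S T : Subobject X} :
    subobjectForget X S ≤ subobjectForget X T ↔ S ≤ T := by
  constructor
  · intro h
    exact Subobject.le_of_comm (liftOfMono T.arrow S.arrow (Subobject.ofMkLEMk _ _ h)
      (Subobject.ofMkLEMk_comp h)) (hom_ext (Subobject.ofMkLEMk_comp h))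
  · intro h
    exact Subobject.mk_le_mk_of_comm (Subobject.ofLE S T h).hom
      (congrArg Hom.hom (Subobject.ofLE_arrow h))

/-- Equivariant subobjects embed into the subobjects of the underlying object. -/
def subobjectEmbedding : Subobject X ↪o Subobject X.obj :=
  OrderEmbedding.ofMapLEIff (subobjectForget X) fun _ _ => subobjectForget_le_iff

instance isNoetherianObject [IsNoetherianObject X.obj] : IsNoetherianObject X :=
  ⟨(subobjectEmbedding X).strictMono.wellFoundedGT⟩

instance isArtinianObject [IsArtinianObject X.obj] : IsArtinianObject X :=
  ⟨(subobjectEmbedding X).strictMono.wellFoundedLT⟩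

/-- Forgetting the action preserves monomorphisms, is injective on morphisms and reflects
isomorphisms. Only this direction is needed, for the unit. -/
lemma simple_of_simple_obj [Simple X.obj] : Simple X where
  mono_isIso_iff_nonzero {Y} f _ := by
    constructor
    · rintro h rfl
      have : IsIso (0 : Y ⟶ X).hom := inferInstanceAs (IsIso ((forget A).map (0 : Y ⟶ X)))
      exact (Simple.mono_isIso_iff_nonzero (0 : Y ⟶ X).hom).1 this rfl
    · intro h
      have : IsIso f.hom := isIso_of_mono_of_nonzero fun h' => h (hom_ext h')
      exact isIso_of_isIso_hom f

end Subobject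

end EquivariantObject

end RightAction

end

/-! ### Translates of morphisms, homogeneous components, and the braiding. -/

noncomputable section

namespace RightAction.EquivariantObject

variable {k : Type w} [Field k] {G : Type*} [Group G] {C : Type u} [Category.{v} C]
  [Preadditive C] [Linear k C] {A : RightAction k G C} (X : A.EquivariantObject)

/-- The translate `ρ^g(U) → X` of a morphism `U → X` to an equivariant object. -/
def act (g : G) {U : C} (f : U ⟶ X.obj) : (A.ρ g).obj U ⟶ X.obj := (A.ρ g).map f ≫ X.r g

lemma act_comp (g : G) {U V : C} (e : U ⟶ V) (f : V ⟶ X.obj) :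
    X.act g (e ≫ f) = (A.ρ g).map e ≫ X.act g f := by
  simp [act]

/-- With `tr_act` and `act_one`, this is how the coherence isomorphisms of the crossed axioms
disappear once composed with translates. -/
lemma act_act (g h : G) {U : C} (f : U ⟶ X.obj) :
    X.act g (X.act h f) = (A.ρ₂ g h).hom.app U ≫ X.act (h * g) f := by
  rw [act, act, Functor.map_comp, Category.assoc, X.r_mul,
    reassoc_of% (ρ₂_naturality (A := A) g h f), act]

lemma tr_act {a b : G} (h : a = b) {U : C} (f : U ⟶ X.obj) :
    A.tr h U ≫ X.act b f = X.act a f := by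
  subst h
  simp [tr]

lemma act_one {U : C} (f : U ⟶ X.obj) : A.ρ₀.hom.app U ≫ X.act 1 f = f := by
  rw [act, ← reassoc_of% (ρ₀_naturality (A := A) f), X.r_one]
  simp

lemma act_comp_hom (g : G) {Y : A.EquivariantObject} {U : C} (f : U ⟶ X.obj) (e : X ⟶ Y) :
    X.act g f ≫ e.hom = Y.act g (f ≫ e.hom) := by
  simp [act, e.comm]

end RightAction.EquivariantObject

namespace Grading.Decomposition

variable {Γ : Type*} [Group Γ] [Fintype Γ] {C : Type u} [Category.{v} C]
    [Preadditive C] [MonoidalCategory C] {𝒢 : Grading Γ C} {X : C} (D : 𝒢.Decomposition X)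

lemma comp_π_eq_zero {s t : Γ} {Z : C} (hZ : 𝒢.deg s Z) (f : Z ⟶ X) (h : s ≠ t) :
    f ≫ D.π t = 0 :=
  𝒢.hom_eq_zero hZ (D.mem t) h _

/-- There are no nonzero morphisms between different degrees, so `f` has only one nonzero component.
-/
lemma comp_π_ι {s : Γ} {Z : C} (hZ : 𝒢.deg s Z) (f : Z ⟶ X) : f ≫ D.π s ≫ D.ι s = f := by
  conv_rhs => rw [← Category.comp_id f, ← D.sum_π_ι, Preadditive.comp_sum]
  rw [Finset.sum_eq_single s]
  · intro t _ ht
    rw [← Category.assoc, D.comp_π_eq_zero hZ f ht.symm, zero_comp]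
  · intro h; exact absurd (Finset.mem_univ s) h

/-- Morphisms from `F(X ⊗ Y)` agree if they do so on all `F(X_s ⊗ Y_t)`. -/
lemma hom_ext_tensor [MonoidalPreadditive C] {Y : C} (E : 𝒢.Decomposition Y) (F : C ⥤ C)
    [F.Additive] {Z : C} {f g : F.obj (X ⊗ Y) ⟶ Z}
    (h : ∀ s t, F.map (D.ι s ⊗ₘ E.ι t) ≫ f = F.map (D.ι s ⊗ₘ E.ι t) ≫ g) : f = g := by
  apply D.hom_ext (tensorRight Y ⋙ F)
  intro s
  apply E.hom_ext (tensorLeft (D.comp s) ⋙ F)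
  intro t
  have := h s t
  rw [MonoidalCategory.tensorHom_def', F.map_comp, Category.assoc, Category.assoc] at this
  exact this

end Grading.Decomposition

namespace MatchedPair

variable {G Γ : Type*} [Group G] [Group Γ] (P : MatchedPair G Γ)

lemma ract_injective (g : G) : Function.Injective fun s => P.ract s g := fun s t h => by
  have := congrArg (fun u => P.ract u g⁻¹) h
  simpa only [← P.ract_mul, mul_inv_cancel, P.ract_one] using this

end MatchedPair

namespace CrossedAction

variable {k : Type w} [Field k] {G Γ : Type*} [Group G] [Group Γ] [Fintype Γ]
  {P : MatchedPair G Γ} {C : Type u} [Category.{v} C] [Preadditive C] [Linear k C]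
  [MonoidalCategory C] [MonoidalPreadditive C] [MonoidalLinear k C] [TensorCategory k C]
  {A : CrossedAction k P C}

open RightAction.EquivariantObject

/-- The form of the tensor product action used from here on: it no longer refers to the
decomposition chosen in `tensorR`. -/
lemma tensor_act (X Y : A.Equivariantization) (g : G) {t : Γ} {U V : C} (hV : A.deg t V)
    (f : U ⟶ X.obj) (f' : V ⟶ Y.obj) :
    (X ⊗ Y).act g (f ⊗ₘ f') =
      (A.γ g U hV).hom ≫ (X.act (P.lact t g) f ⊗ₘ Y.act g f') := by
  change (A.ρ g).map _ ≫ tensorR X Y g = _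
  rw [MonoidalCategory.tensorHom_def, Functor.map_comp, Category.assoc, map_tensorR X Y g hV,
    reassoc_of% (A.γ_natural_left g hV), ← tensorHom_id, tensorHom_comp_tensorHom,
    Category.id_comp, act, act]

section rComp

variable (X : A.Equivariantization) (D : A.Decomposition X.obj) (g : G) (s : Γ)

lemma rComp_ι : rComp X D g s ≫ D.ι (P.ract s g) = X.act g (D.ι s) := by
  have := D.comp_π_ι (A.map_mem g (D.mem s)) (X.act g (D.ι s))
  simpa [rComp, act] using this

/-- The map `u ↦ u ◁ g` is injective, so `r^g` matches the summands `ρ^g(X_u)` with distinct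
summands of `X`; the inverse is the corresponding component of the inverse of `r^g`. -/
instance isIso_rComp : IsIso (rComp X D g s) := by
  have key : ∀ u, u ≠ s → D.ι (P.ract s g) ≫ inv (X.r g) ≫ (A.ρ g).map (D.π u) = 0 :=
    fun u hu => A.hom_eq_zero (D.mem _) (A.map_mem g (D.mem u))
      (fun h => hu (P.ract_injective g h).symm) _
  refine ⟨D.ι (P.ract s g) ≫ inv (X.r g) ≫ (A.ρ g).map (D.π s), ?_, ?_⟩
  · rw [reassoc_of% (rComp_ι X D g s), act, Category.assoc, IsIso.hom_inv_id_assoc,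
      ← Functor.map_comp, D.ι_π_self, CategoryTheory.Functor.map_id]
  · have h1 : D.ι (P.ract s g) ≫ inv (X.r g) ≫ (A.ρ g).map (D.π s ≫ D.ι s) =
        D.ι (P.ract s g) ≫ inv (X.r g) := by
      conv_rhs => rw [← Category.comp_id (inv (X.r g)), ← CategoryTheory.Functor.map_id,
        ← D.sum_π_ι, Functor.map_sum, Preadditive.comp_sum, Preadditive.comp_sum]
      rw [Finset.sum_eq_single s]
      · intro u _ hu
        have := key u hu
        rw [Functor.map_comp, reassoc_of% this, zero_comp]
      · intro h; exact absurd (Finset.mem_univ s) h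
    rw [Functor.map_comp] at h1
    simp only [rComp, Category.assoc]
    rw [reassoc_of% h1, IsIso.inv_hom_id_assoc, D.ι_π_self]

end rComp

/-! ### The braiding: naturality, equivariance, hexagons, invertibility. -/

namespace CrossedBraiding

variable (B : A.CrossedBraiding)

/-- The braiding of `X` and `Y` as a morphism of `C`. -/
def braidingHom (X Y : A.Equivariantization) : X.obj ⊗ Y.obj ⟶ Y.obj ⊗ X.obj :=
  ∑ s : Γ, ∑ t : Γ, ((A.decomp X.obj).π s ⊗ₘ (A.decomp Y.obj).π t) ≫
    (B.c ((A.decomp X.obj).mem s) ((A.decomp Y.obj).mem t)).hom ≫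
      (Y.act (B.lt s t) ((A.decomp Y.obj).ι t) ⊗ₘ X.act (B.ψ t) ((A.decomp X.obj).ι s))

/-- Only the `(s, t)` term of the double sum survives, and naturality of `c` moves the projections
past it. Every later property of the braiding is checked through this formula. -/
lemma tensorHom_braidingHom (X Y : A.Equivariantization) {s t : Γ} {U V : C}
    (hU : A.deg s U) (hV : A.deg t V) (f : U ⟶ X.obj) (f' : V ⟶ Y.obj) :
    (f ⊗ₘ f') ≫ B.braidingHom X Y =
      (B.c hU hV).hom ≫ (Y.act (B.lt s t) f' ⊗ₘ X.act (B.ψ t) f) := by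
  set D := A.decomp X.obj
  set E := A.decomp Y.obj
  simp only [braidingHom, Preadditive.comp_sum]
  rw [Finset.sum_eq_single s, Finset.sum_eq_single t]
  · rw [tensorHom_comp_tensorHom_assoc, reassoc_of% (B.c_natural hU (D.mem s) hV (E.mem t)),
      tensorHom_comp_tensorHom, ← act_comp, ← act_comp, Category.assoc, Category.assoc,
      D.comp_π_ι hU, E.comp_π_ι hV]
  · intro u _ hu
    rw [tensorHom_comp_tensorHom_assoc, E.comp_π_eq_zero hV f' hu.symm]
    simp
  · intro h; exact absurd (Finset.mem_univ t) h
  · intro u _ hu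
    refine Finset.sum_eq_zero fun v _ => ?_
    rw [tensorHom_comp_tensorHom_assoc, D.comp_π_eq_zero hU f hu.symm]
    simp
  · intro h; exact absurd (Finset.mem_univ s) h

lemma ι_tensorHom_braidingHom (X Y : A.Equivariantization) (D : A.Decomposition X.obj)
    (E : A.Decomposition Y.obj) (s t : Γ) :
    (D.ι s ⊗ₘ E.ι t) ≫ B.braidingHom X Y = B.braidingComp X Y D E s t ≫
      (E.ι (P.ract t (P.lact t⁻¹ (B.φ s⁻¹))) ⊗ₘ D.ι (P.ract s (B.ψ t))) := by
  rw [B.tensorHom_braidingHom X Y (D.mem s) (E.mem t), braidingComp, Category.assoc,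
    tensorHom_comp_tensorHom, rComp_ι, rComp_ι]

instance isIso_braidingComp (X Y : A.Equivariantization) (D : A.Decomposition X.obj)
    (E : A.Decomposition Y.obj) (s t : Γ) : IsIso (B.braidingComp X Y D E s t) := by
  unfold braidingComp
  infer_instance

lemma braidingHom_naturality {X X' Y Y' : A.Equivariantization} (f : X ⟶ X') (f' : Y ⟶ Y') :
    (f.hom ⊗ₘ f'.hom) ≫ B.braidingHom X' Y' = B.braidingHom X Y ≫ (f'.hom ⊗ₘ f.hom) := by
  set D := A.decomp X.obj
  set E := A.decomp Y.obj
  apply D.hom_ext_tensor E (𝟭 C)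
  intro s t
  dsimp
  rw [tensorHom_comp_tensorHom_assoc, B.tensorHom_braidingHom X' Y' (D.mem s) (E.mem t),
    reassoc_of% (B.tensorHom_braidingHom X Y (D.mem s) (E.mem t)), tensorHom_comp_tensorHom,
    act_comp_hom, act_comp_hom]

/-- On homogeneous components this is axiom 1 (`c_equivariant`) followed by translates. -/
lemma braidingHom_equivariant (X Y : A.Equivariantization) (g : G) :
    (X ⊗ Y).r g ≫ B.braidingHom X Y = (A.ρ g).map (B.braidingHom X Y) ≫ (Y ⊗ X).r g := by
  set D := A.decomp X.obj
  set E := A.decomp Y.obj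
  apply D.hom_ext_tensor E (A.ρ g)
  intro s t
  have e1 := tensor_act X Y g (E.mem t) (D.ι s) (E.ι t)
  have e2 := tensor_act Y X g (A.map_mem (B.ψ t) (D.mem s)) (Y.act (B.lt s t) (E.ι t))
    (X.act (B.ψ t) (D.ι s))
  rw [act] at e1 e2
  rw [reassoc_of% e1, B.tensorHom_braidingHom X Y (A.map_mem _ (D.mem s)) (A.map_mem _ (E.mem t)),
    ← Functor.map_comp_assoc, B.tensorHom_braidingHom X Y (D.mem s) (E.mem t), Functor.map_comp,
    Category.assoc, e2]
  simp only [act_act, ← tensorHom_comp_tensorHom]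
  rw [← reassoc_of% (B.c_equivariant g (D.mem s) (E.mem t))]
  simp only [tensorHom_comp_tensorHom, tr_act]

/-- On homogeneous components this is axiom 3 (`c_tensor_right`); its `γ` enters through the action
on `Y ⊗ Z`. -/
lemma hexagon_forward (X Y Z : A.Equivariantization) :
    (α_ X.obj Y.obj Z.obj).hom ≫ B.braidingHom X (Y ⊗ Z) ≫ (α_ Y.obj Z.obj X.obj).hom =
      B.braidingHom X Y ▷ Z.obj ≫ (α_ Y.obj X.obj Z.obj).hom ≫ Y.obj ◁ B.braidingHom X Z := by
  set D := A.decomp X.obj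
  set E := A.decomp Y.obj
  set F := A.decomp Z.obj
  apply F.hom_ext (tensorLeft _)
  intro u
  apply D.hom_ext_tensor E (tensorRight _)
  intro s t
  have hs := D.mem s
  have ht := E.mem t
  have hu := F.mem u
  have e : (tensorRight (F.comp u)).map (D.ι s ⊗ₘ E.ι t) ≫
      (tensorLeft (X.obj ⊗ Y.obj)).map (F.ι u) = ((D.ι s ⊗ₘ E.ι t) ⊗ₘ F.ι u) := by
    simp [MonoidalCategory.tensorHom_def]
  rw [reassoc_of% e, reassoc_of% e, associator_naturality_assoc]
  have h1 := B.tensorHom_braidingHom X (Y ⊗ Z) hs (A.tensor_mem ht hu) (D.ι s) (E.ι t ⊗ₘ F.ι u)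
  rw [reassoc_of% h1, tensor_act Y Z _ hu]
  have h2 : ((D.ι s ⊗ₘ E.ι t) ⊗ₘ F.ι u) ≫ B.braidingHom X Y ▷ Z.obj =
      (B.c hs ht).hom ▷ _ ≫ ((Y.act (B.lt s t) (E.ι t) ⊗ₘ X.act (B.ψ t) (D.ι s)) ⊗ₘ F.ι u) := by
    rw [← tensorHom_id, ← tensorHom_id, tensorHom_comp_tensorHom, tensorHom_comp_tensorHom,
      B.tensorHom_braidingHom X Y hs ht, Category.comp_id, Category.id_comp]
  rw [reassoc_of% h2, associator_naturality_assoc, ← id_tensorHom, tensorHom_comp_tensorHom,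
    Category.comp_id, B.tensorHom_braidingHom X Z (A.map_mem _ hs) hu, act_act]
  have h3 := B.c_tensor_right hs ht hu =≫ (Y.act (P.lact u (B.lt s (t * u))) (E.ι t) ⊗ₘ
    (Z.act (B.lt s (t * u)) (F.ι u) ⊗ₘ X.act (B.ψ (t * u)) (D.ι s)))
  simp only [Category.assoc, tensorHom_comp_tensorHom, tr_act, ← associator_naturality,
    ← tensorHom_id, ← id_tensorHom, tensorHom_comp_tensorHom_assoc, Category.id_comp] at h3 ⊢
  exact h3

/-- On homogeneous components this is axiom 2 (`c_tensor_left`); its `γ` enters through the action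
on `X ⊗ Y`. -/
lemma hexagon_reverse (X Y Z : A.Equivariantization) :
    (α_ X.obj Y.obj Z.obj).inv ≫ B.braidingHom (X ⊗ Y) Z ≫ (α_ Z.obj X.obj Y.obj).inv =
      X.obj ◁ B.braidingHom Y Z ≫ (α_ X.obj Z.obj Y.obj).inv ≫ B.braidingHom X Z ▷ Y.obj := by
  set D := A.decomp X.obj
  set E := A.decomp Y.obj
  set F := A.decomp Z.obj
  apply D.hom_ext (tensorRight _)
  intro s
  apply E.hom_ext_tensor F (tensorLeft _)
  intro t u
  have hs := D.mem s
  have ht := E.mem t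
  have hu := F.mem u
  have e : (tensorLeft (D.comp s)).map (E.ι t ⊗ₘ F.ι u) ≫
      (tensorRight (Y.obj ⊗ Z.obj)).map (D.ι s) = (D.ι s ⊗ₘ (E.ι t ⊗ₘ F.ι u)) := by
    simp [MonoidalCategory.tensorHom_def']
  rw [reassoc_of% e, reassoc_of% e, associator_inv_naturality_assoc]
  have h1 := B.tensorHom_braidingHom (X ⊗ Y) Z (A.tensor_mem hs ht) hu (D.ι s ⊗ₘ E.ι t) (F.ι u)
  rw [reassoc_of% h1, tensor_act X Y _ ht]
  have h2 : (D.ι s ⊗ₘ (E.ι t ⊗ₘ F.ι u)) ≫ X.obj ◁ B.braidingHom Y Z =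
      _ ◁ (B.c ht hu).hom ≫ (D.ι s ⊗ₘ (Z.act (B.lt t u) (F.ι u) ⊗ₘ Y.act (B.ψ u) (E.ι t))) := by
    rw [← id_tensorHom, ← id_tensorHom, tensorHom_comp_tensorHom, tensorHom_comp_tensorHom,
      B.tensorHom_braidingHom Y Z ht hu, Category.comp_id, Category.id_comp]
  rw [reassoc_of% h2, associator_inv_naturality_assoc, ← tensorHom_id, tensorHom_comp_tensorHom,
    Category.comp_id, B.tensorHom_braidingHom X Z hs (A.map_mem _ hu), act_act]
  have h3 := B.c_tensor_left hs ht hu =≫ (Z.act (B.lt (s * t) u) (F.ι u) ⊗ₘ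
    (X.act (P.lact t (B.ψ u)) (D.ι s) ⊗ₘ Y.act (B.ψ u) (E.ι t)))
  -- Moves the last associator to the side on which axiom 2 has it.
  rw [← cancel_mono (α_ Z.obj X.obj Y.obj).hom]
  simp only [Category.assoc, tensorHom_comp_tensorHom, tr_act, ← tensorHom_id, ← id_tensorHom,
    tensorHom_comp_tensorHom_assoc, Category.id_comp, ← associator_naturality, Iso.inv_hom_id,
    Category.comp_id] at h3 ⊢
  exact h3

/-- The permutation `(s, t) ↦ (t ◁ (t⁻¹ ▷ φ(s⁻¹)), s ◁ ψ(t))` of the pairs of degrees. -/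
def degreeEquiv : Γ × Γ ≃ Γ × Γ :=
  Equiv.ofBijective (fun p => (P.ract p.2 (B.lt p.1 p.2), P.ract p.1 (B.ψ p.2))) <|
    Finite.injective_iff_bijective.1 <| by
      rintro ⟨s, t⟩ ⟨s', t'⟩ h
      obtain ⟨h₁, h₂⟩ := Prod.ext_iff.1 h
      dsimp only at h₁ h₂
      -- By `lact_φ`, the second coordinate `s ◁ ψ(t)` alone determines `t⁻¹ ▷ φ(s⁻¹)`; cancelling
      -- this element in the first coordinate recovers `t`, and then `s`.
      have e₁ : B.lt s t = B.lt s' t' := by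
        rw [← inv_inj, B.lact_φ, B.lact_φ, h₂]
      rw [e₁] at h₁
      have ht : t = t' := P.ract_injective _ h₁
      subst ht
      rw [P.ract_injective _ h₂]

lemma sum_π_ι_tensor {X Y : C} (D : A.Decomposition X) (E : A.Decomposition Y) :
    ∑ p : Γ × Γ, (D.π p.1 ≫ D.ι p.1 ⊗ₘ E.π p.2 ≫ E.ι p.2) = 𝟙 (X ⊗ Y) := by
  rw [Fintype.sum_prod_type, ← id_tensorHom_id, ← D.sum_π_ι, ← E.sum_π_ι, sum_tensor]
  simp_rw [tensor_sum]

/-- The braiding is a block matrix with one invertible block for each pair of degrees, placed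
according to the permutation `degreeEquiv`; the inverse is assembled from the inverse blocks. -/
instance isIso_braidingHom (X Y : A.Equivariantization) : IsIso (B.braidingHom X Y) := by
  set D := A.decomp X.obj
  set E := A.decomp Y.obj
  have key := B.ι_tensorHom_braidingHom X Y D E
  have hne : ∀ s t u v : Γ, (u, v) ≠ (s, t) →
      (E.ι (P.ract t (P.lact t⁻¹ (B.φ s⁻¹))) ⊗ₘ D.ι (P.ract s (B.ψ t))) ≫
        (E.π (P.ract v (P.lact v⁻¹ (B.φ u⁻¹))) ⊗ₘ D.π (P.ract u (B.ψ v))) = 0 := by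
    intro s t u v h
    rw [tensorHom_comp_tensorHom]
    by_cases h₁ : P.ract t (P.lact t⁻¹ (B.φ s⁻¹)) = P.ract v (P.lact v⁻¹ (B.φ u⁻¹))
    · rw [D.ι_π_ne (P.ract s (B.ψ t)) (P.ract u (B.ψ v)) fun h₂ => h (B.degreeEquiv.injective (a₁ := (s, t)) (a₂ := (u, v))
        (Prod.ext h₁ h₂)).symm]
      simp
    · rw [E.ι_π_ne _ _ h₁]
      simp
  refine ⟨∑ p : Γ × Γ, (E.π (P.ract p.2 (P.lact p.2⁻¹ (B.φ p.1⁻¹))) ⊗ₘ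
    D.π (P.ract p.1 (B.ψ p.2))) ≫ inv (B.braidingComp X Y D E p.1 p.2) ≫
      (D.ι p.1 ⊗ₘ E.ι p.2), ?_, ?_⟩
  · apply D.hom_ext_tensor E (𝟭 C)
    intro s t
    dsimp
    rw [reassoc_of% (key s t), Preadditive.comp_sum, Preadditive.comp_sum,
      Finset.sum_eq_single (s, t)]
    · rw [tensorHom_comp_tensorHom_assoc, E.ι_π_self, D.ι_π_self]
      simp
    · rintro ⟨u, v⟩ _ h
      rw [reassoc_of% (hne s t u v h), zero_comp, comp_zero]
    · intro h; exact absurd (Finset.mem_univ _) h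
  -- The identity of `Y ⊗ X`, a sum over target degrees, is reindexed by source degrees.
  · rw [Preadditive.sum_comp, ← sum_π_ι_tensor E D,
      ← B.degreeEquiv.sum_comp (fun p => (E.π p.1 ≫ E.ι p.1 ⊗ₘ D.π p.2 ≫ D.ι p.2))]
    refine Finset.sum_congr rfl fun p _ => ?_
    rw [Category.assoc, Category.assoc, key, IsIso.inv_hom_id_assoc, tensorHom_comp_tensorHom]
    rfl

/-- The braiding of `C^{(G, Γ)}`. -/
def braidingIso (X Y : A.Equivariantization) : X ⊗ Y ≅ Y ⊗ X :=
  mkIso (asIso (B.braidingHom X Y)) (B.braidingHom_equivariant X Y)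

@[simp]
lemma braidingIso_hom_hom (X Y : A.Equivariantization) :
    (B.braidingIso X Y).hom.hom = B.braidingHom X Y := rfl

/-- The category `C^{(G, Γ)}` is braided. -/
@[reducible]
def braidedCategory : BraidedCategory A.Equivariantization where
  braiding := B.braidingIso
  braiding_naturality_right X _ _ f := hom_ext (by
    have := B.braidingHom_naturality (𝟙 X) f
    simpa using this)
  braiding_naturality_left f Z := hom_ext (by
    have := B.braidingHom_naturality f (𝟙 Z)
    simpa using this)
  hexagon_forward X Y Z := hom_ext (B.hexagon_forward X Y Z)
  hexagon_reverse X Y Z := hom_ext (B.hexagon_reverse X Y Z)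

end CrossedBraiding

end CrossedAction

end

/-! ### Exact pairings and tests against translates. -/

noncomputable section

namespace CategoryTheory.ExactPairing

variable {C : Type u} [Category.{v} C] [MonoidalCategory C] {X Y : C} [ExactPairing X Y]

/-- A morphism `W ⟶ Z ⊗ Y` is determined by its composition with the evaluation. -/
lemma hom_ext_tensor_evaluation {W Z : C} {f f' : W ⟶ Z ⊗ Y}
    (h : f ▷ X ≫ (α_ _ _ _).hom ≫ Z ◁ ε_ X Y ≫ (ρ_ Z).hom =
      f' ▷ X ≫ (α_ _ _ _).hom ≫ Z ◁ ε_ X Y ≫ (ρ_ Z).hom) : f = f' :=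
  (tensorRightHomEquiv W X Y Z).symm.injective h

lemma whiskerRight_leftUnitor_evaluation :
    (λ_ Y).hom ▷ X ≫ ε_ X Y = (α_ _ _ _).hom ≫ 𝟙_ C ◁ ε_ X Y ≫ (ρ_ (𝟙_ C)).hom := by
  rw [← unitors_equal, leftUnitor_naturality]
  simp

/-- A morphism `W ⟶ Y` is determined by the pairing `W ⊗ X ⟶ 𝟙` that it induces. -/
lemma hom_ext_evaluation {W : C} {f f' : W ⟶ Y} (h : f ▷ X ≫ ε_ X Y = f' ▷ X ≫ ε_ X Y) :
    f = f' := by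
  rw [← cancel_mono (λ_ Y).inv]
  apply hom_ext_tensor_evaluation (X := X)
  rw [← whiskerRight_leftUnitor_evaluation, ← comp_whiskerRight_assoc, ← comp_whiskerRight_assoc]
  simpa using h

/-- Each pairing `W ⊗ X ⟶ 𝟙` is induced by a morphism `W ⟶ Y`. -/
lemma exists_hom_of_pairing {W : C} (ω : W ⊗ X ⟶ 𝟙_ C) : ∃ f : W ⟶ Y, f ▷ X ≫ ε_ X Y = ω := by
  refine ⟨tensorRightHomEquiv W X Y (𝟙_ C) ω ≫ (λ_ Y).hom, ?_⟩
  rw [comp_whiskerRight_assoc, whiskerRight_leftUnitor_evaluation]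
  exact (tensorRightHomEquiv W X Y (𝟙_ C)).left_inv ω

end CategoryTheory.ExactPairing

namespace RightAction

variable {k : Type w} [Field k] {G : Type*} [Group G] {C : Type u} [Category.{v} C]
  [Preadditive C] [Linear k C] {A : RightAction k G C}

lemma tr_rfl {a : G} (X : C) : A.tr (rfl : a = a) X = 𝟙 _ := rfl

@[simp]
lemma tr_tr {a b c : G} (h : a = b) (h' : b = c) (X : C) :
    A.tr h X ≫ A.tr h' X = A.tr (h.trans h') X := by
  simp [tr]

/-- Translating by `g⁻¹` and back by `g` changes `f` only by the identification of `U` with `ρ^g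
ρ^{g⁻¹}(U)`. -/
lemma EquivariantObject.exists_act_eq (X : A.EquivariantObject) (g : G) {U : C} (f : U ⟶ X.obj) :
    ∃ e : U ⟶ (A.ρ g).obj ((A.ρ g⁻¹).obj U), f = e ≫ X.act g (X.act g⁻¹ f) :=
  ⟨A.ρ₀.hom.app U ≫ A.tr (inv_mul_cancel g).symm U ≫ (A.ρ₂ g g⁻¹).inv.app U, by
    simp [act_act, tr_act, act_one]⟩

end RightAction

namespace CrossedAction

variable {k : Type w} [Field k] {G Γ : Type*} [Group G] [Group Γ] [Fintype Γ]
  {P : MatchedPair G Γ} {C : Type u} [Category.{v} C] [Preadditive C] [Linear k C]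
  [MonoidalCategory C] [MonoidalPreadditive C] [MonoidalLinear k C] [TensorCategory k C]
  {A : CrossedAction k P C}

open RightAction RightAction.EquivariantObject

/-- Morphisms from `W ⊗ X` are determined by their compositions with the translates `ρ^g(U) → X`
of the morphisms to `X` from the objects `U ∈ C_s` with `s ▷ g = a`. -/
lemma hom_ext_act (X : A.Equivariantization) (a : G) {W Z : C} {F F' : W ⊗ X.obj ⟶ Z}
    (H : ∀ (s : Γ) (g : G) (U : C) (_ : A.deg s U) (f : U ⟶ X.obj), P.lact s g = a →
      W ◁ X.act g f ≫ F = W ◁ X.act g f ≫ F') : F = F' := by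
  apply (A.decomp X.obj).hom_ext (tensorLeft W)
  intro t
  set D := A.decomp X.obj
  -- The solution of `s ▷ g = a`, `s ◁ g = t`: with `g = s⁻¹ ▷ a`, the second equation reads `(s⁻¹ ◁
  -- a)⁻¹ = t`. Then `ρ^{g⁻¹}(X_t)` has degree `s`.
  set s := (P.ract t⁻¹ a⁻¹)⁻¹ with hs
  set g := P.lact s⁻¹ a with hg
  have hsg : P.ract t g⁻¹ = s := by
    have h1 : P.ract s g = t := by
      rw [hg, P.ract_lact_inv, hs, inv_inv, ← P.ract_mul, inv_mul_cancel, P.ract_one, inv_inv]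
    rw [← h1, ← P.ract_mul, mul_inv_cancel, P.ract_one]
  obtain ⟨e, he⟩ := X.exists_act_eq g (D.ι t)
  have := H s g _ (hsg ▸ A.map_mem g⁻¹ (D.mem t)) (X.act g⁻¹ (D.ι t)) (P.lact_lact_inv s a)
  dsimp
  rw [he, MonoidalCategory.whiskerLeft_comp, Category.assoc, Category.assoc, this]

/-! ### Duals in `C^{(G, Γ)}` and the tensor category structure. -/

section Dual

variable (X : A.Equivariantization) (Y : C) [ExactPairing X.obj Y]

/-- The pairing `ρ^a(Y) ⊗ X → 𝟙` that is induced by the evaluation `Y ⊗ X → 𝟙`. -/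
def dualPairing (a : G) : (A.ρ a).obj Y ⊗ X.obj ⟶ 𝟙_ C :=
  -- The element `g = s⁻¹ ▷ a` is the one with `s ▷ g = a`, so that `γ^g` identifies `ρ^g(Y ⊗ X_s)`
  -- with `ρ^a(Y) ⊗ ρ^g(X_s)`.
  ∑ s : Γ, (A.tr (P.lact_lact_inv s a).symm Y ⊗ₘ (inv (X.r (P.lact s⁻¹ a)) ≫
      (A.ρ (P.lact s⁻¹ a)).map ((A.decomp X.obj).π s))) ≫
    (A.γ (P.lact s⁻¹ a) Y ((A.decomp X.obj).mem s)).inv ≫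
      (A.ρ (P.lact s⁻¹ a)).map (Y ◁ (A.decomp X.obj).ι s ≫ ε_ X.obj Y) ≫
        (A.γ₀ (P.lact s⁻¹ a)).hom

lemma γ_inv_natural (g : G) {t : Γ} {X X' Y Y' : C} (hY : A.deg t Y) (hY' : A.deg t Y')
    (f : X ⟶ X') (f' : Y ⟶ Y') :
    (A.γ g X hY).inv ≫ (A.ρ g).map (f ⊗ₘ f') =
      ((A.ρ (P.lact t g)).map f ⊗ₘ (A.ρ g).map f') ≫ (A.γ g X' hY').inv := by
  rw [Iso.inv_comp_eq, ← Category.assoc, Iso.eq_comp_inv, A.γ_natural g hY hY' f f']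

/-- Frees the pairing from the chosen decomposition: it is computed on the translate of any morphism
from an object of degree `s`. -/
lemma act_dualPairing {s : Γ} (a g : G) (ha : P.lact s g = a) {U : C} (hU : A.deg s U)
    (f : U ⟶ X.obj) :
    (A.tr ha Y ⊗ₘ X.act g f) ≫ dualPairing X Y a =
      (A.γ g Y hU).inv ≫ (A.ρ g).map (Y ◁ f ≫ ε_ X.obj Y) ≫ (A.γ₀ g).hom := by
  obtain rfl : g = P.lact s⁻¹ a := by rw [← ha, P.lact_inv_lact]
  set D := A.decomp X.obj
  rw [dualPairing, Preadditive.comp_sum, Finset.sum_eq_single s]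
  · rw [tensorHom_comp_tensorHom_assoc, tr_tr, tr_rfl, act, Category.assoc,
      IsIso.hom_inv_id_assoc, ← Functor.map_comp]
    have h := γ_inv_natural (P.lact s⁻¹ a) hU (D.mem s) (𝟙 Y) (f ≫ D.π s)
    rw [CategoryTheory.Functor.map_id] at h
    rw [← reassoc_of% h, ← Functor.map_comp_assoc, id_tensorHom,
      ← MonoidalCategory.whiskerLeft_comp_assoc, Category.assoc, D.comp_π_ι hU]
  · intro u _ hu
    -- The degrees of source and target are `(s⁻¹ ◁ a)⁻¹` and `(u⁻¹ ◁ a)⁻¹`, which differ for `u ≠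
    -- s`.
    have hz : X.act (P.lact s⁻¹ a) f ≫ inv (X.r (P.lact u⁻¹ a)) ≫
        (A.ρ (P.lact u⁻¹ a)).map (D.π u) = 0 := by
      refine A.hom_eq_zero (A.map_mem _ hU) (A.map_mem _ (D.mem u)) (fun h => hu ?_) _
      rw [P.ract_lact_inv, P.ract_lact_inv, inv_inj] at h
      exact (inv_injective (P.ract_injective a h)).symm
    rw [tensorHom_comp_tensorHom_assoc, hz]
    simp
  · intro h; exact absurd (Finset.mem_univ s) h

/-- The action on the dual `Y` of `X`. -/
def dualR (a : G) : (A.ρ a).obj Y ⟶ Y :=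
  (ExactPairing.exists_hom_of_pairing (X := X.obj) (dualPairing X Y a)).choose

lemma dualR_evaluation (a : G) : dualR X Y a ▷ X.obj ≫ ε_ X.obj Y = dualPairing X Y a :=
  (ExactPairing.exists_hom_of_pairing (X := X.obj) (dualPairing X Y a)).choose_spec

lemma tr_dualR {a b : G} (h : a = b) : A.tr h Y ≫ dualR X Y b = dualR X Y a := by
  subst h
  rw [tr_rfl, Category.id_comp]

/-- Equivariance of the evaluation, in the language of translates. The action axioms for the dual
are derived from it. -/
lemma dualR_act_evaluation {s : Γ} (g : G) {U : C} (hU : A.deg s U) {W : C} (h : W ⟶ Y)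
    (f : U ⟶ X.obj) :
    (((A.ρ (P.lact s g)).map h ≫ dualR X Y (P.lact s g)) ⊗ₘ X.act g f) ≫ ε_ X.obj Y =
      (A.γ g W hU).inv ≫ (A.ρ g).map ((h ⊗ₘ f) ≫ ε_ X.obj Y) ≫ (A.γ₀ g).hom := by
  have e := act_dualPairing X Y _ g rfl hU f
  rw [tr_rfl, id_tensorHom] at e
  have hn := γ_inv_natural g hU hU h (𝟙 U)
  rw [tensorHom_id, CategoryTheory.Functor.map_id, tensorHom_id] at hn
  rw [MonoidalCategory.tensorHom_def', comp_whiskerRight, Category.assoc, Category.assoc,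
    dualR_evaluation, whisker_exchange_assoc, e, ← reassoc_of% hn, ← Functor.map_comp_assoc,
    MonoidalCategory.tensorHom_def, Category.assoc]

/-- Both sides are paired with translates of morphisms to `X`; the resulting pairings agree by
`γ_mul` and `γ₀_mul`. -/
lemma dualR_mul (b a : G) :
    (A.ρ b).map (dualR X Y a) ≫ dualR X Y b = (A.ρ₂ b a).hom.app Y ≫ dualR X Y (a * b) := by
  apply ExactPairing.hom_ext_evaluation (X := X.obj)
  apply hom_ext_act X (a * b)
  intro s c U hU f hc
  -- For the degree `s` of `U`, the product `a * b` is rewritten as `s ▷ (h * g) = (s ▷ h)((s ◁ h) ▷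
  -- g)`, the shape in which `γ_mul` applies.
  obtain ⟨h, rfl⟩ : ∃ h, a = P.lact s h := ⟨P.lact s⁻¹ a, (P.lact_lact_inv s a).symm⟩
  obtain ⟨g, rfl⟩ : ∃ g, b = P.lact (P.ract s h) g :=
    ⟨P.lact (P.ract s h)⁻¹ b, (P.lact_lact_inv _ b).symm⟩
  obtain rfl : c = h * g := by
    rw [← P.lact_mul] at hc
    rw [← P.lact_inv_lact s c, hc, P.lact_inv_lact]
  -- Precomposing with the isomorphism `ρ₂` replaces the translate by `h * g` with an iterated one,
  -- so the evaluation formula can be used twice.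
  rw [← cancel_epi (_ ◁ (A.ρ₂ g h).hom.app U), ← MonoidalCategory.whiskerLeft_comp_assoc,
    ← MonoidalCategory.whiskerLeft_comp_assoc, ← act_act, ← MonoidalCategory.tensorHom_def'_assoc,
    ← MonoidalCategory.tensorHom_def'_assoc, dualR_act_evaluation X Y g (A.map_mem h hU)]
  have e := dualR_act_evaluation X Y h hU (𝟙 Y) f
  have e' := dualR_act_evaluation X Y (h * g) hU (𝟙 Y) f
  rw [CategoryTheory.Functor.map_id, Category.id_comp, id_tensorHom] at e e'
  have hm : ((A.ρ₂ (P.lact (P.ract s h) g) (P.lact s h)).hom.app Y ⊗ₘ (A.ρ₂ g h).hom.app U) ≫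
      (A.tr (P.lact_mul s h g).symm Y ▷ _) ≫ (A.γ (h * g) Y hU).inv =
        (A.γ g _ (A.map_mem h hU)).inv ≫ (A.ρ g).map (A.γ h Y hU).inv ≫
          (A.ρ₂ g h).hom.app (Y ⊗ U) := by
    rw [Iso.eq_inv_comp, ← cancel_epi ((A.ρ g).map (A.γ h Y hU).hom),
      ← reassoc_of% (A.γ_mul g h Y hU), ← comp_whiskerRight_assoc, tr_tr, tr_rfl,
      ← Functor.map_comp_assoc]
    simp
  have hR : ((A.ρ₂ (P.lact (P.ract s h) g) (P.lact s h)).hom.app Y ≫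
        dualR X Y (P.lact s h * P.lact (P.ract s h) g) ⊗ₘ X.act g (X.act h f)) ≫ ε_ X.obj Y =
      ((A.ρ₂ (P.lact (P.ract s h) g) (P.lact s h)).hom.app Y ⊗ₘ (A.ρ₂ g h).hom.app U) ≫
      (A.tr (P.lact_mul s h g).symm Y ▷ _) ≫ (dualR X Y (P.lact s (h * g)) ⊗ₘ X.act (h * g) f) ≫
        ε_ X.obj Y := by
    rw [← tensorHom_id, tensorHom_comp_tensorHom_assoc, tensorHom_comp_tensorHom_assoc,
      Category.assoc, tr_dualR, Category.comp_id, act_act]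
  have hn := ρ₂_naturality (A := A.toRightAction) g h (Y ◁ f ≫ ε_ X.obj Y)
  rw [e, hR, e', reassoc_of% hm, ← reassoc_of% hn, A.γ₀_mul]
  simp only [Functor.map_comp, Category.assoc]

lemma dualR_one : A.ρ₀.hom.app Y ≫ dualR X Y 1 = 𝟙 Y := by
  apply ExactPairing.hom_ext_evaluation (X := X.obj)
  apply (A.decomp X.obj).hom_ext (tensorLeft Y)
  intro s
  set D := A.decomp X.obj
  have e' := dualR_act_evaluation X Y 1 (D.mem s) (𝟙 Y) (D.ι s)
  rw [CategoryTheory.Functor.map_id, Category.id_comp, id_tensorHom] at e'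
  have hR : Y ◁ D.ι s ≫ (A.ρ₀.hom.app Y ≫ dualR X Y 1) ▷ X.obj ≫ ε_ X.obj Y =
      (A.ρ₀.hom.app Y ⊗ₘ A.ρ₀.hom.app (D.comp s)) ≫ (A.tr (P.lact_one s).symm Y ▷ _) ≫
        (dualR X Y (P.lact s 1) ⊗ₘ X.act 1 (D.ι s)) ≫ ε_ X.obj Y := by
    rw [← tensorHom_id, ← tensorHom_id, ← id_tensorHom, tensorHom_comp_tensorHom_assoc,
      tensorHom_comp_tensorHom_assoc, tensorHom_comp_tensorHom_assoc, Category.assoc, tr_dualR,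
      Category.comp_id, Category.comp_id, act_one]
    simp
  have hn := ρ₀_naturality (A := A.toRightAction) (Y ◁ D.ι s ≫ ε_ X.obj Y)
  dsimp
  rw [hR, e', ← A.γ_one Y (D.mem s)]
  simp only [Category.assoc]
  rw [← comp_whiskerRight_assoc, tr_tr, tr_rfl, id_whiskerRight, Category.id_comp,
    Iso.hom_inv_id_assoc, ← reassoc_of% hn, A.γ₀_one]
  simp

/-- The dual of `X` in `C^{(G, Γ)}`. -/
abbrev dual : A.Equivariantization where
  obj := Y
  r := dualR X Y
  isIso_r := A.isIso_of_mul_one _ (dualR_mul X Y) (dualR_one X Y)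
  r_mul := dualR_mul X Y
  r_one := dualR_one X Y

/-- The evaluation as a morphism of `C^{(G, Γ)}`. -/
def dualEvaluation : dual X Y ⊗ X ⟶ 𝟙_ A.Equivariantization where
  hom := ε_ X.obj Y
  comm g := by
    apply (A.decomp X.obj).hom_ext (tensorLeft Y ⋙ A.ρ g)
    intro s
    set D := A.decomp X.obj
    have e := tensor_act (dual X Y) X g (D.mem s) (𝟙 Y) (D.ι s)
    have e' := dualR_act_evaluation X Y g (D.mem s) (𝟙 Y) (D.ι s)
    rw [id_tensorHom] at e e'
    rw [act, act] at e
    change (A.ρ g).map (Y ◁ D.ι s) ≫ _ ≫ _ = (A.ρ g).map (Y ◁ D.ι s) ≫ _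
    rw [reassoc_of% e, e', Iso.hom_inv_id_assoc, Functor.map_comp, Category.assoc]
    rfl

/-- The coevaluation as a morphism of `C^{(G, Γ)}`. -/
def dualCoevaluation : 𝟙_ A.Equivariantization ⟶ X ⊗ dual X Y where
  hom := η_ X.obj Y
  comm g := by
    apply ExactPairing.hom_ext_tensor_evaluation (X := X.obj)
    apply hom_ext_act X g
    rintro s h U hU f rfl
    have e := tensor_act (X ⊗ dual X Y) X h hU (η_ X.obj Y) f
    -- This map is equivariant because the evaluation is, and the zigzag identity turns `η` followed
    -- by it into the left unitor. Comparing translates through it yields the equivariance of `η`.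
    let m : (X ⊗ dual X Y) ⊗ X ⟶ X := (α_ _ _ _).hom ≫ X ◁ dualEvaluation X Y ≫ (ρ_ X).hom
    have hm : m.hom = (α_ _ _ _).hom ≫ X.obj ◁ ε_ X.obj Y ≫ (ρ_ X.obj).hom := rfl
    have hz : η_ X.obj Y ▷ X.obj ≫ m.hom = (λ_ X.obj).hom := by
      rw [hm, reassoc_of% (ExactPairing.evaluation_coevaluation X.obj Y), Iso.inv_hom_id,
        Category.comp_id]
    have h1 := act_comp_hom ((X ⊗ dual X Y) ⊗ X) h (η_ X.obj Y ⊗ₘ f) m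
    rw [e, MonoidalCategory.tensorHom_def' (η_ X.obj Y)] at h1
    simp only [Category.assoc] at h1
    rw [hz, leftUnitor_naturality, act_comp, ← A.γ_unit_left h hU, Category.assoc, Category.assoc,
      Iso.cancel_iso_hom_left] at h1
    change _ ◁ X.act h f ≫ ((A.γ₀ (P.lact s h)).hom ≫ η_ X.obj Y) ▷ X.obj ≫ m.hom =
      _ ◁ X.act h f ≫ (X ⊗ dual X Y).act (P.lact s h) (η_ X.obj Y) ▷ X.obj ≫ m.hom
    rw [comp_whiskerRight_assoc, hz, whisker_exchange_assoc, leftUnitor_naturality, ← h1,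
      MonoidalCategory.tensorHom_def', Category.assoc]

/-- An exact pairing of the underlying objects gives one in `C^{(G, Γ)}`. -/
instance exactPairingDual : ExactPairing X (dual X Y) where
  coevaluation' := dualCoevaluation X Y
  evaluation' := dualEvaluation X Y
  coevaluation_evaluation' := hom_ext (ExactPairing.coevaluation_evaluation X.obj Y)
  evaluation_coevaluation' := hom_ext (ExactPairing.evaluation_coevaluation X.obj Y)

end Dual

/-- The category `C^{(G, Γ)}` has right duals. -/
@[reducible]
def rightRigidCategory [RightRigidCategory C] : RightRigidCategory A.Equivariantization where
  rightDual X := ⟨dual X (HasRightDual.rightDual X.obj)⟩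

/-- The category `C^{(G, Γ)}` is a tensor category if it is rigid. -/
lemma tensorCategory_of_rigid (h : Nonempty (RigidCategory A.Equivariantization)) :
    TensorCategory k A.Equivariantization := by
  let : Abelian C :=
    { toPreadditive := inferInstance
      toIsNormalMonoCategory := TensorCategory.isNormalMonoCategory k
      toIsNormalEpiCategory := TensorCategory.isNormalEpiCategory k
      has_finite_products := TensorCategory.hasFiniteProducts k
      has_kernels := TensorCategory.hasKernels k
      has_cokernels := TensorCategory.hasCokernels k }
  exact
    { hasFiniteProducts := inferInstanceAs (HasFiniteProducts A.toRightAction.EquivariantObject)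
      hasKernels := inferInstanceAs (HasKernels A.toRightAction.EquivariantObject)
      hasCokernels := inferInstanceAs (HasCokernels A.toRightAction.EquivariantObject)
      isNormalMonoCategory :=
        inferInstanceAs (IsNormalMonoCategory A.toRightAction.EquivariantObject)
      isNormalEpiCategory :=
        inferInstanceAs (IsNormalEpiCategory A.toRightAction.EquivariantObject)
      rigid := h
      finiteDimensional_hom := fun X Y =>
        have := TensorCategory.finiteDimensional_hom (k := k) X.obj Y.obj
        inferInstance
      isNoetherianObject := fun X =>
        have := TensorCategory.isNoetherianObject k X.obj
        RightAction.EquivariantObject.isNoetherianObject X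
      isArtinianObject := fun X =>
        have := TensorCategory.isArtinianObject k X.obj
        RightAction.EquivariantObject.isArtinianObject X
      simple_unit :=
        have : Simple (𝟙_ A.Equivariantization).obj := TensorCategory.simple_unit (C := C) k
        simple_of_simple_obj _ }

end CrossedAction

end

theorem theorem7p4 {k : Type w} [Field k] [IsAlgClosed k] {G Γ : Type*} [Group G] [Finite G]
    [Group Γ] [Fintype Γ] {P : MatchedPair G Γ} {C : Type u} [Category.{v} C] [Preadditive C]
    [Linear k C] [MonoidalCategory C] [MonoidalPreadditive C] [MonoidalLinear k C]
    [TensorCategory k C] (A : CrossedAction k P C) (B : A.CrossedBraiding) :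
    TensorCategory k A.Equivariantization ∧
      ∃ σ : BraidedCategory A.Equivariantization,
        ∀ (X Y : A.Equivariantization) (D : A.Decomposition X.obj) (E : A.Decomposition Y.obj)
          (s t : Γ),
          IsIso (B.braidingComp X Y D E s t) ∧
            (D.ι s ⊗ₘ E.ι t) ≫ (σ.braiding X Y).hom.hom =
              B.braidingComp X Y D E s t ≫
                (E.ι (P.ract t (P.lact t⁻¹ (B.φ s⁻¹))) ⊗ₘ D.ι (P.ract s (B.ψ t))) := by
  refine ⟨CrossedAction.tensorCategory_of_rigid ?_, B.braidedCategory, fun X Y D E s t =>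
    ⟨inferInstance, B.ι_tensorHom_braidingHom X Y D E s t⟩⟩
  obtain ⟨_⟩ := TensorCategory.rigid (C := C) k
  -- Only right duals were constructed; the braiding makes them left duals as well.
  let := B.braidedCategory
  let : RightRigidCategory A.Equivariantization := CrossedAction.rightRigidCategory
  exact ⟨BraidedCategory.rigidCategoryOfRightRigidCategory⟩
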